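/- All graphs are finite, simple and undirected, and networks are connected graphs. A graph $G$ is *2-connected* if it is connected and has no cut-vertex, i.e. no vertex $v$ such that $G\setminus\{v\}$ contains two vertices not joined by a path (a single edge is thus 2-connected). A *two-terminal series-parallel graph* is a graph with a source and a sink built recursively as follows: a single edge is series-parallel, its endpoints being the source and the sink; the series composition of two series-parallel graphs (identify the sink of the first with the source of the second) and their parallel composition (identify the two sources, and identify the two sinks) are series-parallel. A (simple) graph is *series-parallel* if it is a two-terminal series-parallel graph for some choice of source and sink. Fix $k\in\mathbb N$. In a network $G$ with $n$ vertices, the vertices carry pairwise distinct identifiers from $\{1,\dots,n^k\}$. A *certificate assignment* gives each vertex a finite bit string. A *verifier* is a function (the same for all networks) that maps the local view of a vertex $v$, namely the identifier and certificate of $v$ together with the set of the pairs (identifier, certificate) of the neighbours of $v$, to accept or reject. A class $\mathcal C$ of graphs *can be certified with $f(n)$-bit labels* if there is a verifier such that, for every connected graph $G$ with $n$ vertices and every such assignment of identifiers: if $G\in\mathcal C$, there is a certificate assignment with certificates of length at most $f(n)$ for which all vertices accept; if $G\notin\mathcal C$, then for every certificate assignment (of any length) at least one vertex rejects. **Theorem.**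 For every $k\in\mathbb N$ there is a function $f:\mathbb N\to\mathbb N$ with $f(n)=O(\log n)$ such that the class of 2-connected series-parallel graphs can be certified with $f(n)$-bit labels. -/

import Mathlib

/-! ### Two-terminal series-parallel graphs and 2-connectivity -/

namespace LocalCert

/-- `IsTwoTerminalSP G H s t`: the subgraph `H` of `G` is a two-terminal series-parallel graph with
source `s` and sink `t`.  The gluing operations are expressed inside the ambient graph `G`: the two
parts are subgraphs of `G` that share exactly the identified vertices.  All graphs are simple, so in
a parallel composition the two parts have no common edge (no edge is doubled). -/
inductive IsTwoTerminalSP {V : Type*} (G : SimpleGraph V) : G.Subgraph → V → V → Prop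
  | edge {s t : V} (h : G.Adj s t) : IsTwoTerminalSP G (G.subgraphOfAdj h) s t
  | series {H₁ H₂ : G.Subgraph} {s m t : V}
      (h₁ : IsTwoTerminalSP G H₁ s m) (h₂ : IsTwoTerminalSP G H₂ m t)
      (hverts : H₁.verts ∩ H₂.verts = {m}) :
      IsTwoTerminalSP G (H₁ ⊔ H₂) s t
  | parallel {H₁ H₂ : G.Subgraph} {s t : V}
      (h₁ : IsTwoTerminalSP G H₁ s t) (h₂ : IsTwoTerminalSP G H₂ s t)
      (hverts : H₁.verts ∩ H₂.verts = {s, t})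
      (hedges : Disjoint H₁.edgeSet H₂.edgeSet) :
      IsTwoTerminalSP G (H₁ ⊔ H₂) s t

/-- A graph is series-parallel if it is a two-terminal series-parallel graph for some choice of the
source and the sink. -/
def IsSeriesParallel {V : Type*} (G : SimpleGraph V) : Prop :=
  ∃ s t : V, IsTwoTerminalSP G ⊤ s t

/-- Removing `v` leaves two vertices that are not joined by a path. -/
def IsCutVertex {V : Type*} (G : SimpleGraph V) (v : V) : Prop :=
  ¬ (G.induce ({v}ᶜ : Set V)).Preconnected

/-- A connected graph without cut-vertex (a single edge is allowed). -/
def IsTwoConnected {V : Type*} (G : SimpleGraph V) : Prop :=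
  G.Connected ∧ ∀ v : V, ¬ IsCutVertex G v

/-! ### Local certification at distance one (proof-labeling schemes) -/

/-- A class of graphs. -/
abbrev GraphClass := (V : Type) → SimpleGraph V → Prop

/-- What a node sees: its own identifier and certificate, and the set of the pairs
(identifier, certificate) of its neighbours. -/
structure LocalView where
  ident : ℕ
  cert : List Bool
  nbrs : Set (ℕ × List Bool)

/-- The view of the node `v` in `G` under the identifiers `ident` and the certificates `c`. -/
def localView {V : Type} (G : SimpleGraph V) (ident : V → ℕ) (c : V → List Bool) (v : V) :
    LocalView where
  ident := ident v
  cert := c v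
  nbrs := (fun w => (ident w, c w)) '' G.neighborSet v

/-- A verifier decides, from the view of a node only, whether that node accepts. -/
abbrev Verifier := LocalView → Bool

/-- All nodes accept. -/
def Verifier.Accepts (A : Verifier) {V : Type} (G : SimpleGraph V) (ident : V → ℕ)
    (c : V → List Bool) : Prop :=
  ∀ v : V, A (localView G ident c v) = true

/-- Identifiers are pairwise distinct and lie in the range `[1, n ^ k]`, `n` being the number of
nodes. -/
def IsIdentifierAssignment (k : ℕ) {V : Type} [Fintype V] (ident : V → ℕ) : Prop :=
  Function.Injective ident ∧ ∀ v : V, 1 ≤ ident v ∧ ident v ≤ Fintype.card V ^ k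

/-- `CertifiableWith k C f`: when networks are connected graphs with identifiers in `[1, n ^ k]`,
the class `C` can be certified with labels on the nodes of at most `f n` bits.  The bound on the
size concerns the graphs of `C`; on the other connected graphs, certificates of all sizes have to be
rejected by some node. -/
def CertifiableWith (k : ℕ) (C : GraphClass) (f : ℕ → ℕ) : Prop :=
  ∃ A : Verifier, ∀ (V : Type) [Fintype V] (G : SimpleGraph V), G.Connected →
    ∀ ident : V → ℕ, IsIdentifierAssignment k ident →
      (C V G → ∃ c : V → List Bool,
        (∀ v : V, (c v).length ≤ f (Fintype.card V)) ∧ A.Accepts G ident c) ∧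
      (¬ C V G → ∀ c : V → List Bool, ¬ A.Accepts G ident c)

/-- The class of 2-connected series-parallel graphs. -/
def twoConnectedSeriesParallel : GraphClass :=
  fun _ G => IsTwoConnected G ∧ IsSeriesParallel G

end LocalCert

/-! In a series-parallel decomposition, every vertex other than the terminals `s`, `t` is the middle
vertex of exactly one series composition. Label it by the two terminals of that composition, its
pair. The pair of `x` is either `(s, t)` or is formed by an earlier middle vertex `p`, the parent of
`x`, and one end of the pair of `p`. Moreover every edge other than `st` joins a vertex to an end of
its own pair. These conditions, together with a depth that increases away from the root and the
non-emptiness of both sides of each series composition, are the axioms of `SPLabelling`. They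
suffice to rebuild the decomposition: the component of `x`, its pair plus its descendants, is the
series composition of two parallel bundles of components of its children
(`isTwoTerminalSP_component`).

A series-parallel graph is 2-connected when it has the edge `st` or two components with pair `(s,
t)`: once a vertex is deleted, every other vertex still reaches a terminal, and the terminals still
reach each other (`SPLabelling.twoConnectedSeriesParallel`). Conversely, a 2-connected graph cannot
have a series composition as its last step.

All axioms speak of a vertex and its neighbours, except that a vertex must know the label of its
parent, which may be far away. Labels are therefore forwarded, and each vertex must carry only
boundedly many. A scheme lets each vertex forward at most one label besides that of its parent. The
invariant of the structural induction is the existence of connections between the terminals whose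
inner vertices forward nothing yet: one for any composition, two independent ones for an edge or a
parallel composition. A series composition whose first or last factor is of the latter kind spends
one connection to inform its middle vertex and keeps the other (`HasDoubleScheme.series`,
`IsTwoTerminalSP.hasScheme`).

A forwarded label comes with a distance that decreases towards its owner, so no label can be forged.
A certificate is thus made of 35 numbers polynomial in `n`, hence of `O(log n)` bits. -/

namespace LocalCert

open Relation

/-! ### Basic facts on two-terminal series-parallel subgraphs -/

namespace IsTwoTerminalSP

variable {V : Type*} {G : SimpleGraph V}

theorem source_mem {H : G.Subgraph} {s t : V} (h : IsTwoTerminalSP G H s t) : s ∈ H.verts := by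
  induction h with
  | edge h => simp
  | series _ _ _ ih _ => exact Or.inl ih
  | parallel _ _ _ _ ih _ => exact Or.inl ih

theorem sink_mem {H : G.Subgraph} {s t : V} (h : IsTwoTerminalSP G H s t) : t ∈ H.verts := by
  induction h with
  | edge h => simp
  | series _ _ _ _ ih => exact Or.inr ih
  | parallel _ _ _ _ ih _ => exact Or.inl ih

theorem ne {H : G.Subgraph} {s t : V} (h : IsTwoTerminalSP G H s t) : s ≠ t := by
  induction h with
  | edge h => exact h.ne
  | @series H₁ H₂ s m t h₁ h₂ hv ih₁ ih₂ =>
    rintro rfl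
    have : s ∈ H₁.verts ∩ H₂.verts := ⟨h₁.source_mem, h₂.sink_mem⟩
    rw [hv] at this
    exact ih₁ this
  | parallel _ _ _ _ ih _ => exact ih

theorem connected {H : G.Subgraph} {s t : V} (h : IsTwoTerminalSP G H s t) : H.Connected := by
  induction h with
  | edge h => exact SimpleGraph.Subgraph.subgraphOfAdj_connected h
  | @series H₁ H₂ s m t h₁ h₂ hv ih₁ ih₂ =>
    exact SimpleGraph.Subgraph.connected_sup ih₁.preconnected ih₂.preconnected ⟨m, h₁.sink_mem, h₂.source_mem⟩
  | @parallel H₁ H₂ s t h₁ h₂ hv he ih₁ ih₂ =>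
    exact SimpleGraph.Subgraph.connected_sup ih₁.preconnected ih₂.preconnected ⟨s, h₁.source_mem, h₂.source_mem⟩

end IsTwoTerminalSP

theorem disjoint_edgeSet_of_verts_inter {V : Type*} {G : SimpleGraph V} {H₁ H₂ : G.Subgraph}
    {u v : V} (hv : H₁.verts ∩ H₂.verts = {u, v}) (h : ¬ H₂.Adj u v) :
    Disjoint H₁.edgeSet H₂.edgeSet := by
  rw [Set.disjoint_left]
  intro e
  induction e with
  | h p q =>
    simp only [SimpleGraph.Subgraph.mem_edgeSet]
    intro h₁ h₂
    have hp : p ∈ H₁.verts ∩ H₂.verts := ⟨h₁.fst_mem, h₂.fst_mem⟩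
    have hq : q ∈ H₁.verts ∩ H₂.verts := ⟨h₁.snd_mem, h₂.snd_mem⟩
    rw [hv] at hp hq
    have := h₁.ne
    rcases hp with rfl | rfl <;> rcases hq with rfl | rfl
    · exact this rfl
    · exact h h₂
    · exact h h₂.symm
    · exact this rfl

/-- Parallel composition of a finite family of subgraphs with a first one. -/
theorem IsTwoTerminalSP.sup_family {V : Type*} {G : SimpleGraph V} {u v : V} {H : G.Subgraph}
    (hH : IsTwoTerminalSP G H u v) (C : V → G.Subgraph) (Y : Finset V)
    (hC : ∀ y ∈ Y, IsTwoTerminalSP G (C y) u v)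
    (hadj : ∀ y ∈ Y, ¬ (C y).Adj u v)
    (hHC : ∀ y ∈ Y, H.verts ∩ (C y).verts ⊆ {u, v})
    (hCC : ∀ y ∈ Y, ∀ z ∈ Y, y ≠ z → (C y).verts ∩ (C z).verts ⊆ {u, v}) :
    ∃ K, IsTwoTerminalSP G K u v ∧ K.verts = H.verts ∪ ⋃ y ∈ Y, (C y).verts ∧
      ∀ p q, K.Adj p q ↔ H.Adj p q ∨ ∃ y ∈ Y, (C y).Adj p q := by
  classical
  induction Y using Finset.induction_on with
  | empty => exact ⟨H, hH, by simp, by simp⟩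
  | insert z Y hz ih =>
    obtain ⟨K, hK, hKv, hKa⟩ := ih (fun y hy => hC y (by simp [hy])) (fun y hy => hadj y (by simp [hy]))
      (fun y hy => hHC y (by simp [hy]))
      (fun y hy w hw => hCC y (by simp [hy]) w (by simp [hw]))
    have hzC := hC z (by simp)
    have hv : K.verts ∩ (C z).verts = {u, v} := by
      apply Set.Subset.antisymm
      · rintro w ⟨hw, hwz⟩
        rw [hKv] at hw
        rcases hw with hw | hw
        · exact hHC z (by simp) ⟨hw, hwz⟩
        · simp only [Set.mem_iUnion] at hw
          obtain ⟨y, hy, hw⟩ := hw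
          exact hCC y (by simp [hy]) z (by simp) (by rintro rfl; exact hz hy) ⟨hw, hwz⟩
      · rintro w (rfl | rfl)
        · exact ⟨hK.source_mem, hzC.source_mem⟩
        · exact ⟨hK.sink_mem, hzC.sink_mem⟩
    refine ⟨K ⊔ C z, .parallel hK hzC hv (disjoint_edgeSet_of_verts_inter hv (hadj z (by simp))),
      ?_, ?_⟩
    · ext w
      simp only [SimpleGraph.Subgraph.verts_sup, hKv, Set.mem_union, Set.mem_iUnion,
        Finset.mem_insert, exists_prop, exists_eq_or_imp]
      rw [or_assoc, or_comm (b := w ∈ (C z).verts)]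
    · intro p q
      simp only [SimpleGraph.Subgraph.sup_adj, hKa, Finset.mem_insert, exists_eq_or_imp]
      rw [or_assoc, or_comm (b := (C z).Adj p q)]

/-- Parallel composition of a finite family of subgraphs together with the edge between the
terminals, if there is one. -/
theorem exists_isTwoTerminalSP_family {V : Type*} {G : SimpleGraph V} {u v : V}
    (C : V → G.Subgraph) (Y : Finset V)
    (hC : ∀ y ∈ Y, IsTwoTerminalSP G (C y) u v)
    (hadj : ∀ y ∈ Y, ¬ (C y).Adj u v)
    (hCC : ∀ y ∈ Y, ∀ z ∈ Y, y ≠ z → (C y).verts ∩ (C z).verts ⊆ {u, v})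
    (hne : G.Adj u v ∨ Y.Nonempty) :
    ∃ K, IsTwoTerminalSP G K u v ∧ K.verts = {u, v} ∪ ⋃ y ∈ Y, (C y).verts ∧
      ∀ p q, K.Adj p q ↔ (G.Adj p q ∧ (p = u ∧ q = v ∨ p = v ∧ q = u)) ∨
        ∃ y ∈ Y, (C y).Adj p q := by
  classical
  by_cases huv : G.Adj u v
  -- There is no empty series-parallel graph to start from: the composition begins with the edge if
  -- it exists, otherwise with one member of the family.
  · obtain ⟨K, hK, hv, ha⟩ := (IsTwoTerminalSP.edge huv).sup_family C Y hC hadj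
      (fun y _ => by rw [SimpleGraph.subgraphOfAdj_verts]; exact Set.inter_subset_left) hCC
    refine ⟨K, hK, by rw [hv, SimpleGraph.subgraphOfAdj_verts], fun p q => ?_⟩
    rw [ha]
    have : (G.subgraphOfAdj huv).Adj p q ↔ G.Adj p q ∧ (p = u ∧ q = v ∨ p = v ∧ q = u) := by
      simp only [SimpleGraph.subgraphOfAdj_adj, Sym2.eq_iff]
      constructor
      · rintro (⟨rfl, rfl⟩ | ⟨rfl, rfl⟩)
        · exact ⟨huv, by simp⟩
        · exact ⟨huv.symm, by simp⟩
      · tauto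
    rw [this]
  · obtain ⟨z, hz⟩ := hne.resolve_left huv
    obtain ⟨K, hK, hv, ha⟩ := (hC z hz).sup_family C (Y.erase z)
      (fun y hy => hC y (Finset.mem_of_mem_erase hy))
      (fun y hy => hadj y (Finset.mem_of_mem_erase hy))
      (fun y hy => hCC z hz y (Finset.mem_of_mem_erase hy) (Finset.ne_of_mem_erase hy).symm)
      (fun y hy w hw => hCC y (Finset.mem_of_mem_erase hy) w (Finset.mem_of_mem_erase hw))
    refine ⟨K, hK, ?_, fun p q => ?_⟩
    · rw [hv]
      ext w
      simp only [Set.mem_union, Set.mem_iUnion, Finset.mem_erase, Set.mem_insert_iff,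
        Set.mem_singleton_iff, exists_prop]
      constructor
      · rintro (h | ⟨y, ⟨_, hy⟩, h⟩)
        · exact Or.inr ⟨z, hz, h⟩
        · exact Or.inr ⟨y, hy, h⟩
      · rintro ((rfl | rfl) | ⟨y, hy, h⟩)
        · exact Or.inl (hC z hz).source_mem
        · exact Or.inl (hC z hz).sink_mem
        · by_cases hyz : y = z
          · exact Or.inl (hyz ▸ h)
          · exact Or.inr ⟨y, ⟨hyz, hy⟩, h⟩
    · rw [ha]
      constructor
      · rintro (h | ⟨y, hy, h⟩)
        · exact Or.inr ⟨z, hz, h⟩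
        · exact Or.inr ⟨y, Finset.mem_of_mem_erase hy, h⟩
      · rintro (⟨h, ⟨rfl, rfl⟩ | ⟨rfl, rfl⟩⟩ | ⟨y, hy, h⟩)
        · exact absurd h huv
        · exact absurd h.symm huv
        · by_cases hyz : y = z
          · exact Or.inl (hyz ▸ h)
          · exact Or.inr ⟨y, Finset.mem_erase.2 ⟨hyz, hy⟩, h⟩

/-! ### Labellings by series pairs -/

/-- Every vertex `x` other than the terminals `s`, `t` carries a pair `(a x, b x)`, thought of as the
terminals of the series composition whose middle vertex is `x`, and a depth `τ x`. -/
structure SPLabelling {V : Type*} (G : SimpleGraph V) (s t : V) (a b : V → V) (τ : V → ℕ) :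
    Prop where
  ne : s ≠ t
  parent : ∀ x, x ≠ s → x ≠ t → (a x = s ∧ b x = t) ∨
    ∃ p, p ≠ s ∧ p ≠ t ∧ τ p < τ x ∧ ((b x = p ∧ a x = a p) ∨ (a x = p ∧ b x = b p))
  edge : ∀ u v, G.Adj u v → (u = s ∧ v = t) ∨ (u = t ∧ v = s) ∨
    (v ≠ s ∧ v ≠ t ∧ (u = a v ∨ u = b v)) ∨ (u ≠ s ∧ u ≠ t ∧ (v = a u ∨ v = b u))
  left : ∀ x, x ≠ s → x ≠ t → ∃ y, G.Adj x y ∧ (y = a x ∨ (y ≠ s ∧ y ≠ t ∧ b y = x))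
  right : ∀ x, x ≠ s → x ≠ t → ∃ y, G.Adj x y ∧ (y = b x ∨ (y ≠ s ∧ y ≠ t ∧ a y = x))

namespace SPLabelling

variable {V : Type*} {G : SimpleGraph V} {s t : V} {a b : V → V} {τ : V → ℕ}

theorem swap (L : SPLabelling G s t a b τ) : SPLabelling G t s b a τ where
  ne := L.ne.symm
  parent x h₁ h₂ := by
    rcases L.parent x h₂ h₁ with h | ⟨p, h₃, h₄, h₅, h₆⟩
    · exact Or.inl h.symm
    · exact Or.inr ⟨p, h₄, h₃, h₅, h₆.symm⟩
  edge u v h := by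
    have := L.edge u v h
    tauto
  left x h₁ h₂ := by
    obtain ⟨y, h, h'⟩ := L.right x h₂ h₁
    exact ⟨y, h, by tauto⟩
  right x h₁ h₂ := by
    obtain ⟨y, h, h'⟩ := L.left x h₂ h₁
    exact ⟨y, h, by tauto⟩

/-- `p` is the parent of `x`: the pair of `x` is `(a p, p)` or `(p, b p)`. -/
def IsParent (s t : V) (a b : V → V) (τ : V → ℕ) (x p : V) : Prop :=
  (x ≠ s ∧ x ≠ t) ∧ (p ≠ s ∧ p ≠ t) ∧ τ p < τ x ∧ ((b x = p ∧ a x = a p) ∨ (a x = p ∧ b x = b p))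

/-- `z` is `x` or a descendant of `x`. -/
abbrev Desc (s t : V) (a b : V → V) (τ : V → ℕ) (z x : V) : Prop :=
  ReflTransGen (IsParent s t a b τ) z x

/-- An end of the pair of `x` is the parent of `x` or is inherited from it, so by induction it is a
terminal or lies at a smaller depth. -/
theorem depth_left (L : SPLabelling G s t a b τ) : ∀ x, x ≠ s → x ≠ t → a x ≠ s → a x ≠ t →
    τ (a x) < τ x := by
  intro x
  induction hn : τ x using Nat.strong_induction_on generalizing x with
  | _ n ih =>
    subst hn
    intro h₁ h₂ h₃ h₄
    rcases L.parent x h₁ h₂ with h | ⟨p, h₅, h₆, h₇, ⟨rfl, h₈⟩ | ⟨rfl, h₈⟩⟩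
    · exact absurd h.1 h₃
    · rw [h₈] at h₃ h₄ ⊢
      exact (ih _ h₇ _ rfl h₅ h₆ h₃ h₄).trans h₇
    · exact h₇

theorem depth_right (L : SPLabelling G s t a b τ) (x : V) (h₁ : x ≠ s) (h₂ : x ≠ t)
    (h₃ : b x ≠ s) (h₄ : b x ≠ t) : τ (b x) < τ x :=
  L.swap.depth_left x h₂ h₁ h₄ h₃

theorem left_ne_right (L : SPLabelling G s t a b τ) {x : V} (h₁ : x ≠ s) (h₂ : x ≠ t) :
    a x ≠ b x := by
  intro h
  rcases L.parent x h₁ h₂ with h' | ⟨p, h₅, h₆, h₇, ⟨rfl, h₈⟩ | ⟨rfl, h₈⟩⟩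
  · exact L.ne (h'.1 ▸ h'.2 ▸ h)
  · have := L.depth_left (b x) h₅ h₆ (by rwa [← h₈, h]) (by rwa [← h₈, h])
    rw [← h₈, h] at this
    exact this.false
  · have := L.depth_right (a x) h₅ h₆ (by rwa [← h₈, ← h]) (by rwa [← h₈, ← h])
    rw [← h₈, ← h] at this
    exact this.false

theorem left_ne (L : SPLabelling G s t a b τ) {x : V} (h₁ : x ≠ s) (h₂ : x ≠ t) : a x ≠ x := by
  intro h
  have := L.depth_left x h₁ h₂ (by rwa [h]) (by rwa [h])
  rw [h] at this
  exact this.false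

/-- If both ends of the pair of `x` were parents, each would be an end of the pair of the other, and
each would be less deep than the other. -/
theorem parent_unique (L : SPLabelling G s t a b τ) {x p q : V} (hp : IsParent s t a b τ x p)
    (hq : IsParent s t a b τ x q) : p = q := by
  obtain ⟨hx, hps, hpx, hp⟩ := hp
  obtain ⟨-, hqs, hqx, hq⟩ := hq
  rcases hp with ⟨rfl, hp⟩ | ⟨rfl, hp⟩ <;> rcases hq with ⟨hq, hq'⟩ | ⟨hq, hq'⟩
  · exact hq
  · subst hq
    have h₁ := L.depth_left (b x) hps.1 hps.2 (by rw [← hp]; exact hqs.1) (by rw [← hp]; exact hqs.2)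
    have h₂ := L.depth_right (a x) hqs.1 hqs.2 (by rw [← hq']; exact hps.1)
      (by rw [← hq']; exact hps.2)
    rw [← hp] at h₁
    rw [← hq'] at h₂
    omega
  · subst hq
    have h₁ := L.depth_left (b x) hqs.1 hqs.2 (by rw [← hq']; exact hps.1)
      (by rw [← hq']; exact hps.2)
    have h₂ := L.depth_right (a x) hps.1 hps.2 (by rw [← hp]; exact hqs.1)
      (by rw [← hp]; exact hqs.2)
    rw [← hq'] at h₁
    rw [← hp] at h₂
    omega
  · exact hq

theorem desc_depth {z x : V} (h : Desc s t a b τ z x) : τ x ≤ τ z := by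
  induction h with
  | refl => exact le_rfl
  | tail _ h ih => exact h.2.2.1.le.trans ih

theorem desc_nonterminal {z x : V} (h : Desc s t a b τ z x) (hx : x ≠ s ∧ x ≠ t) :
    z ≠ s ∧ z ≠ t := by
  rcases h.cases_head with rfl | ⟨_, h, _⟩
  · exact hx
  · exact h.1

/-- On the way up from `z` to `x`, a left end is either inherited or is itself the next vertex of
the chain. Thus edges towards the ends of a pair do not leave the component. -/
theorem desc_left {z x : V} (h : Desc s t a b τ z x) :
    a z = a x ∨ a z = b x ∨ Desc s t a b τ (a z) x := by
  induction h using ReflTransGen.head_induction_on with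
  | refl => exact Or.inl rfl
  | head h h' ih =>
    obtain ⟨-, -, -, ⟨-, h⟩ | ⟨rfl, -⟩⟩ := h
    · rwa [h]
    · exact Or.inr (Or.inr h')

theorem desc_right {z x : V} (h : Desc s t a b τ z x) :
    b z = a x ∨ b z = b x ∨ Desc s t a b τ (b z) x := by
  induction h using ReflTransGen.head_induction_on with
  | refl => exact Or.inr (Or.inl rfl)
  | head h h' ih =>
    obtain ⟨-, -, -, ⟨rfl, -⟩ | ⟨-, h⟩⟩ := h
    · exact Or.inr (Or.inr h')
    · rwa [h]

theorem desc_iff {z x : V} :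
    Desc s t a b τ z x ↔ z = x ∨ ∃ y, IsParent s t a b τ y x ∧ Desc s t a b τ z y := by
  constructor
  · intro h
    rcases h.cases_tail with rfl | ⟨y, h, h'⟩
    · exact Or.inl rfl
    · exact Or.inr ⟨y, h', h⟩
  · rintro (rfl | ⟨y, h, h'⟩)
    · exact .refl
    · exact h'.tail h

/-- Distinct vertices with the same parent, if any, have no common descendant. -/
theorem not_desc_of_desc (L : SPLabelling G s t a b τ) {y y' z : V}
    (hyy : ∀ p, IsParent s t a b τ y p ↔ IsParent s t a b τ y' p) (hne : y ≠ y')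
    (h : Desc s t a b τ z y) : ¬ Desc s t a b τ z y' := by
  have key : ∀ y y', (∀ p, IsParent s t a b τ y p ↔ IsParent s t a b τ y' p) → y ≠ y' →
      ¬ Desc s t a b τ y y' := by
    intro y y' hyy hne h
    rcases h.cases_head with rfl | ⟨p, hp, h⟩
    · exact hne rfl
    · have := desc_depth h
      have := ((hyy p).1 hp).2.2.1
      omega
  intro h'
  -- Parents are unique, so the ancestors of `z` form a chain and one of `y`, `y'` would descend
  -- from the other.
  rcases ReflTransGen.total_of_right_unique
    (r := IsParent s t a b τ) (fun x p q h₁ h₂ => L.parent_unique h₁ h₂) h h' with h'' | h''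
  · exact key y y' hyy hne h''
  · exact key y' y (fun p => (hyy p).symm) hne.symm h''

/-! ### Components, and the decomposition rebuilt from a labelling -/

variable (G s t a b τ) in
/-- The component hanging at `x`: the edges whose later end is `x` or a descendant of `x`. -/
def component (x : V) : G.Subgraph where
  verts := {a x, b x} ∪ {z | Desc s t a b τ z x}
  Adj u v := G.Adj u v ∧ ((Desc s t a b τ v x ∧ (u = a v ∨ u = b v)) ∨
    (Desc s t a b τ u x ∧ (v = a u ∨ v = b u)))
  adj_sub h := h.1
  edge_vert := by
    rintro u v ⟨-, ⟨h, rfl | rfl⟩ | ⟨h, -⟩⟩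
    · have := desc_left h
      simp only [Set.mem_union, Set.mem_insert_iff, Set.mem_singleton_iff, Set.mem_ofPred_eq]
      tauto
    · have := desc_right h
      simp only [Set.mem_union, Set.mem_insert_iff, Set.mem_singleton_iff, Set.mem_ofPred_eq]
      tauto
    · exact Or.inr h
  symm := ⟨fun u v h => ⟨h.1.symm, h.2.symm⟩⟩

theorem component_verts (x : V) :
    (component G s t a b τ x).verts = {a x, b x} ∪ {z | Desc s t a b τ z x} := rfl

theorem component_adj (x u v : V) : (component G s t a b τ x).Adj u v ↔
    G.Adj u v ∧ ((Desc s t a b τ v x ∧ (u = a v ∨ u = b v)) ∨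
    (Desc s t a b τ u x ∧ (v = a u ∨ v = b u))) := Iff.rfl

theorem not_desc_left (L : SPLabelling G s t a b τ) {x : V} (h₁ : x ≠ s) (h₂ : x ≠ t) :
    ¬ Desc s t a b τ (a x) x := by
  intro h
  have := desc_nonterminal h ⟨h₁, h₂⟩
  have := L.depth_left x h₁ h₂ this.1 this.2
  have := desc_depth h
  omega

theorem not_desc_right (L : SPLabelling G s t a b τ) {x : V} (h₁ : x ≠ s) (h₂ : x ≠ t) :
    ¬ Desc s t a b τ (b x) x := by
  intro h
  have := desc_nonterminal h ⟨h₁, h₂⟩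
  have := L.depth_right x h₁ h₂ this.1 this.2
  have := desc_depth h
  omega

theorem not_component_adj (L : SPLabelling G s t a b τ) {x : V} (h₁ : x ≠ s) (h₂ : x ≠ t) :
    ¬ (component G s t a b τ x).Adj (a x) (b x) := by
  rintro ⟨-, ⟨h, -⟩ | ⟨h, -⟩⟩
  · exact L.not_desc_right h₁ h₂ h
  · exact L.not_desc_left h₁ h₂ h

/-- Components with the same pair share only their terminals. -/
theorem component_inter (L : SPLabelling G s t a b τ) {y y' : V}
    (hy : y ≠ s ∧ y ≠ t) (hy' : y' ≠ s ∧ y' ≠ t) (ha : a y = a y') (hb : b y = b y')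
    (hne : y ≠ y') :
    (component G s t a b τ y).verts ∩ (component G s t a b τ y').verts ⊆ {a y, b y} := by
  -- Being a parent depends only on the pair: the depth condition follows from `depth_left` and
  -- `depth_right`.
  have hpar : ∀ p, IsParent s t a b τ y p ↔ IsParent s t a b τ y' p := by
    have : ∀ y y', (y ≠ s ∧ y ≠ t) → (y' ≠ s ∧ y' ≠ t) → a y = a y' → b y = b y' →
        ∀ p, IsParent s t a b τ y p → IsParent s t a b τ y' p := by
      rintro y y' hy hy' ha hb p ⟨-, hp, hlt, h⟩
      rw [ha, hb] at h
      refine ⟨hy', hp, ?_, h⟩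
      rcases h with ⟨rfl, -⟩ | ⟨rfl, -⟩
      · exact L.depth_right _ hy'.1 hy'.2 hp.1 hp.2
      · exact L.depth_left _ hy'.1 hy'.2 hp.1 hp.2
    exact fun p => ⟨this y y' hy hy' ha hb p, this y' y hy' hy ha.symm hb.symm p⟩
  rintro z ⟨hz | hz, hz' | hz'⟩
  · exact hz
  · exact hz
  · rwa [ha, hb]
  · exact absurd hz' (L.not_desc_of_desc hpar hne hz)

/-- The axiom only provides a neighbour `y` with right end `x`, which is what `x` can see. As long
as the parent of `y` is not `x`, it is the left end of `y` and has the same right end; climbing this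
way ends at a child of `x` with pair `(a x, x)`. This makes the left bundle of `x` non-empty. -/
theorem exists_left_child (L : SPLabelling G s t a b τ) {x : V} (h₁ : x ≠ s) (h₂ : x ≠ t) :
    G.Adj (a x) x ∨ ∃ y, (y ≠ s ∧ y ≠ t) ∧ a y = a x ∧ b y = x := by
  obtain ⟨y, hxy, rfl | ⟨hys, hyt, hy⟩⟩ := L.left x h₁ h₂
  · exact Or.inl hxy.symm
  · right
    clear hxy
    induction hn : τ y using Nat.strong_induction_on generalizing y with
    | _ n ih =>
      subst hn
      rcases L.parent y hys hyt with h | ⟨p, h₅, h₆, h₇, ⟨h₈, h₉⟩ | ⟨rfl, h₈⟩⟩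
      · exact absurd (hy ▸ h.2) h₂
      · rw [hy] at h₈
        subst h₈
        exact ⟨y, ⟨hys, hyt⟩, h₉, hy⟩
      · exact ih _ h₇ (a y) h₅ h₆ (h₈ ▸ hy) rfl

theorem exists_right_child (L : SPLabelling G s t a b τ) {x : V} (h₁ : x ≠ s) (h₂ : x ≠ t) :
    G.Adj x (b x) ∨ ∃ y, (y ≠ s ∧ y ≠ t) ∧ a y = x ∧ b y = b x := by
  rcases L.swap.exists_left_child h₂ h₁ with h | ⟨y, h, h', h''⟩
  · exact Or.inl h.symm
  · exact Or.inr ⟨y, h.symm, h'', h'⟩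

/-- The parallel composition of all components with pair `(u, v)` and of the edge `uv`, if there is
one. -/
theorem exists_bundle [Finite V] (L : SPLabelling G s t a b τ) {u v : V}
    (hC : ∀ y, y ≠ s ∧ y ≠ t → a y = u → b y = v →
      IsTwoTerminalSP G (component G s t a b τ y) u v)
    (hne : G.Adj u v ∨ ∃ y, (y ≠ s ∧ y ≠ t) ∧ a y = u ∧ b y = v) :
    ∃ K, IsTwoTerminalSP G K u v ∧
      (∀ z, z ∈ K.verts ↔ z = u ∨ z = v ∨
        ∃ y, (y ≠ s ∧ y ≠ t) ∧ a y = u ∧ b y = v ∧ Desc s t a b τ z y) ∧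
      ∀ p q, K.Adj p q ↔ (G.Adj p q ∧ (p = u ∧ q = v ∨ p = v ∧ q = u)) ∨
        ∃ y, (y ≠ s ∧ y ≠ t) ∧ a y = u ∧ b y = v ∧ (component G s t a b τ y).Adj p q := by
  classical
  have := Fintype.ofFinite V
  let Y : Finset V := {y | (y ≠ s ∧ y ≠ t) ∧ a y = u ∧ b y = v}
  have hY : ∀ y, y ∈ Y ↔ (y ≠ s ∧ y ≠ t) ∧ a y = u ∧ b y = v := fun y => by simp [Y]
  obtain ⟨K, hK, hv, ha⟩ := exists_isTwoTerminalSP_family (component G s t a b τ) Y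
    (fun y hy => hC y ((hY y).1 hy).1 ((hY y).1 hy).2.1 ((hY y).1 hy).2.2)
    (fun y hy => by
      obtain ⟨h, rfl, rfl⟩ := (hY y).1 hy
      exact L.not_component_adj h.1 h.2)
    (fun y hy z hz hyz => by
      obtain ⟨h, rfl, rfl⟩ := (hY y).1 hy
      obtain ⟨h', h₁, h₂⟩ := (hY z).1 hz
      exact L.component_inter h h' h₁.symm h₂.symm hyz)
    (hne.imp_right fun ⟨y, hy⟩ => ⟨y, (hY y).2 hy⟩)
  refine ⟨K, hK, fun z => ?_, fun p q => ?_⟩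
  · rw [hv]
    simp only [Set.mem_union, Set.mem_insert_iff, Set.mem_singleton_iff, Set.mem_iUnion,
      exists_prop, hY, component_verts, Set.mem_ofPred_eq]
    constructor
    · rintro ((h | h) | ⟨y, ⟨hy, rfl, rfl⟩, (h | h) | h⟩)
      · exact Or.inl h
      · exact Or.inr (Or.inl h)
      · exact Or.inl h
      · exact Or.inr (Or.inl h)
      · exact Or.inr (Or.inr ⟨y, hy, rfl, rfl, h⟩)
    · rintro (h | h | ⟨y, hy, rfl, rfl, h⟩)
      · exact Or.inl (Or.inl h)
      · exact Or.inl (Or.inr h)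
      · exact Or.inr ⟨y, ⟨hy, rfl, rfl⟩, Or.inr h⟩
  · rw [ha]
    simp only [hY, and_assoc]

/-- The children of `x` have pair `(a x, x)` or `(x, b x)`. Bundling each kind with the
corresponding edge, if present, gives two graphs that meet only in `x`, and the component of `x` is
their series composition. -/
theorem isTwoTerminalSP_component [Finite V] (L : SPLabelling G s t a b τ) :
    ∀ x, x ≠ s → x ≠ t → IsTwoTerminalSP G (component G s t a b τ x) (a x) (b x) := by
  -- The induction runs from the deepest vertices upwards, which is well-founded as `V` is finite.
  have wf : WellFounded (fun y x : V => τ x < τ y) :=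
    @Finite.wellFounded_of_trans_of_irrefl V _ (fun y x : V => τ x < τ y)
      ⟨fun _ _ _ h₁ h₂ => h₂.trans h₁⟩ ⟨fun _ => lt_irrefl _⟩
  intro x
  induction x using wf.induction with
  | _ x ih =>
  intro h₁ h₂
  have hleft : ∀ y, y ≠ s ∧ y ≠ t → a y = a x → b y = x → IsParent s t a b τ y x :=
    fun y hy hay hby => ⟨hy, ⟨h₁, h₂⟩, by
      have := L.depth_right y hy.1 hy.2 (hby ▸ h₁) (hby ▸ h₂)
      rwa [hby] at this, Or.inl ⟨hby, hay⟩⟩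
  have hright : ∀ y, y ≠ s ∧ y ≠ t → a y = x → b y = b x → IsParent s t a b τ y x :=
    fun y hy hay hby => ⟨hy, ⟨h₁, h₂⟩, by
      have := L.depth_left y hy.1 hy.2 (hay ▸ h₁) (hay ▸ h₂)
      rwa [hay] at this, Or.inr ⟨hay, hby⟩⟩
  obtain ⟨A, hA, hAv, hAa⟩ := L.exists_bundle (u := a x) (v := x)
    (fun y hy hay hby => by
      have := ih y (hleft y hy hay hby).2.2.1 hy.1 hy.2
      rwa [hay, hby] at this) (L.exists_left_child h₁ h₂)
  obtain ⟨B, hB, hBv, hBa⟩ := L.exists_bundle (u := x) (v := b x)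
    (fun y hy hay hby => by
      have := ih y (hright y hy hay hby).2.2.1 hy.1 hy.2
      rwa [hay, hby] at this) (L.exists_right_child h₁ h₂)
  have hdesc : ∀ z, Desc s t a b τ z x ↔ z = x ∨
      (∃ y, (y ≠ s ∧ y ≠ t) ∧ a y = a x ∧ b y = x ∧ Desc s t a b τ z y) ∨
      (∃ y, (y ≠ s ∧ y ≠ t) ∧ a y = x ∧ b y = b x ∧ Desc s t a b τ z y) := by
    intro z
    rw [desc_iff]
    constructor
    · rintro (h | ⟨y, ⟨hy, -, -, h | h⟩, hz⟩)
      · exact Or.inl h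
      · exact Or.inr (Or.inl ⟨y, hy, h.2, h.1, hz⟩)
      · exact Or.inr (Or.inr ⟨y, hy, h.1, h.2, hz⟩)
    · rintro (h | ⟨y, hy, hay, hby, hz⟩ | ⟨y, hy, hay, hby, hz⟩)
      · exact Or.inl h
      · exact Or.inr ⟨y, hleft y hy hay hby, hz⟩
      · exact Or.inr ⟨y, hright y hy hay hby, hz⟩
  have hAx : ∀ y z, (y ≠ s ∧ y ≠ t) → a y = a x → b y = x → Desc s t a b τ z y →
      Desc s t a b τ z x := fun y z hy hay hby hz => hz.tail (hleft y hy hay hby)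
  have hBx : ∀ y z, (y ≠ s ∧ y ≠ t) → a y = x → b y = b x → Desc s t a b τ z y →
      Desc s t a b τ z x := fun y z hy hay hby hz => hz.tail (hright y hy hay hby)
  have hinter : A.verts ∩ B.verts = {x} := by
    apply Set.Subset.antisymm
    · rintro z ⟨hz, hz'⟩
      rw [hAv] at hz
      rw [hBv] at hz'
      rw [Set.mem_singleton_iff]
      rcases hz with rfl | rfl | ⟨y, hy, hay, hby, hz⟩
      · rcases hz' with h | h | ⟨y, hy, hay, hby, hz⟩
        · exact h
        · exact absurd h (L.left_ne_right h₁ h₂)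
        · exact absurd (hBx _ _ hy hay hby hz) (L.not_desc_left h₁ h₂)
      · rfl
      · rcases hz' with h | rfl | ⟨y', hy', hay', hby', hz'⟩
        · exact h
        · exact absurd (hAx _ _ hy hay hby hz) (L.not_desc_right h₁ h₂)
        -- `z` would descend from a left child and from a right child of `x`, which are distinct
        -- vertices with the same parent.
        · refine absurd hz' (L.not_desc_of_desc (fun p => ?_) ?_ hz)
          · have h := hleft y hy hay hby
            have h' := hright y' hy' hay' hby'
            exact ⟨fun hp => L.parent_unique h hp ▸ h', fun hp => L.parent_unique h' hp ▸ h⟩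
          · rintro rfl
            exact L.left_ne h₁ h₂ (hay.symm.trans hay')
    · rintro z rfl
      exact ⟨hA.sink_mem, hB.source_mem⟩
  have heq : component G s t a b τ x = A ⊔ B := by
    ext p q
    · simp only [SimpleGraph.Subgraph.verts_sup, Set.mem_union, hAv, hBv, component_verts,
        Set.mem_insert_iff, Set.mem_singleton_iff, Set.mem_ofPred_eq, hdesc]
      have (e f g P Q : Prop) : (e ∨ f) ∨ g ∨ P ∨ Q ↔ (e ∨ g ∨ P) ∨ g ∨ f ∨ Q := by tauto
      exact this _ _ _ _ _
    · simp only [SimpleGraph.Subgraph.sup_adj, hAa, hBa, component_adj]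
      constructor
      · have key : ∀ p q, G.Adj p q → Desc s t a b τ q x → (p = a q ∨ p = b q) →
            (p = a x ∧ q = x) ∨ (q = x ∧ p = b x) ∨
            (∃ y, (y ≠ s ∧ y ≠ t) ∧ a y = a x ∧ b y = x ∧ Desc s t a b τ q y) ∨
            (∃ y, (y ≠ s ∧ y ≠ t) ∧ a y = x ∧ b y = b x ∧ Desc s t a b τ q y) := by
          intro p q hpq hq hp
          rcases (hdesc q).1 hq with rfl | h
          · tauto
          · exact Or.inr (Or.inr h)
        rintro ⟨hpq, ⟨hq, hp⟩ | ⟨hp, hq⟩⟩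
        · rcases key p q hpq hq hp with h | h | ⟨y, h, h', h'', h₃⟩ | ⟨y, h, h', h'', h₃⟩
          · exact Or.inl (Or.inl ⟨hpq, Or.inl h⟩)
          · exact Or.inr (Or.inl ⟨hpq, Or.inr h.symm⟩)
          · exact Or.inl (Or.inr ⟨y, h, h', h'', hpq, Or.inl ⟨h₃, hp⟩⟩)
          · exact Or.inr (Or.inr ⟨y, h, h', h'', hpq, Or.inl ⟨h₃, hp⟩⟩)
        · rcases key q p hpq.symm hp hq with h | h | ⟨y, h, h', h'', h₃⟩ | ⟨y, h, h', h'', h₃⟩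
          · exact Or.inl (Or.inl ⟨hpq, Or.inr h.symm⟩)
          · exact Or.inr (Or.inl ⟨hpq, Or.inl h⟩)
          · exact Or.inl (Or.inr ⟨y, h, h', h'', hpq, Or.inr ⟨h₃, hq⟩⟩)
          · exact Or.inr (Or.inr ⟨y, h, h', h'', hpq, Or.inr ⟨h₃, hq⟩⟩)
      · have hxx : Desc s t a b τ x x := .refl
        rintro ((⟨hpq, ⟨rfl, rfl⟩ | ⟨rfl, rfl⟩⟩ | ⟨y, hy, hay, hby, hpq, h⟩) |
          (⟨hpq, ⟨rfl, rfl⟩ | ⟨rfl, rfl⟩⟩ | ⟨y, hy, hay, hby, hpq, h⟩))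
        · exact ⟨hpq, Or.inl ⟨hxx, Or.inl rfl⟩⟩
        · exact ⟨hpq, Or.inr ⟨hxx, Or.inl rfl⟩⟩
        · exact ⟨hpq, h.imp (fun h => ⟨hAx _ _ hy hay hby h.1, h.2⟩)
            (fun h => ⟨hAx _ _ hy hay hby h.1, h.2⟩)⟩
        · exact ⟨hpq, Or.inr ⟨hxx, Or.inr rfl⟩⟩
        · exact ⟨hpq, Or.inl ⟨hxx, Or.inr rfl⟩⟩
        · exact ⟨hpq, h.imp (fun h => ⟨hBx _ _ hy hay hby h.1, h.2⟩)
            (fun h => ⟨hBx _ _ hy hay hby h.1, h.2⟩)⟩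
  rw [heq]
  exact .series hA hB hinter

theorem exists_root (L : SPLabelling G s t a b τ) {x : V} (h₁ : x ≠ s) (h₂ : x ≠ t) :
    ∃ y, (y ≠ s ∧ y ≠ t) ∧ a y = s ∧ b y = t ∧ Desc s t a b τ x y := by
  induction hn : τ x using Nat.strong_induction_on generalizing x with
  | _ n ih =>
    subst hn
    rcases L.parent x h₁ h₂ with h | ⟨p, h₃, h₄, h₅, h₆⟩
    · exact ⟨x, ⟨h₁, h₂⟩, h.1, h.2, .refl⟩
    · obtain ⟨y, hy, hay, hby, h⟩ := ih _ h₅ h₃ h₄ rfl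
      exact ⟨y, hy, hay, hby, h.head ⟨⟨h₁, h₂⟩, ⟨h₃, h₄⟩, h₅, h₆⟩⟩

/-- Climbing to a vertex without parent shows that every vertex lies in a component with pair `(s,
t)`, so the bundle at `(s, t)` is the whole graph. -/
theorem isTwoTerminalSP_top [Finite V] (L : SPLabelling G s t a b τ) (hG : G.Connected) :
    IsTwoTerminalSP G ⊤ s t := by
  have hne : G.Adj s t ∨ ∃ y, (y ≠ s ∧ y ≠ t) ∧ a y = s ∧ b y = t := by
    by_cases h : ∃ x, x ≠ s ∧ x ≠ t
    · obtain ⟨x, h₁, h₂⟩ := h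
      obtain ⟨y, hy, hay, hby, -⟩ := L.exists_root h₁ h₂
      exact Or.inr ⟨y, hy, hay, hby⟩
    · push Not at h
      left
      have : Nontrivial V := ⟨s, t, L.ne⟩
      obtain ⟨w, hw⟩ := hG.preconnected.exists_adj_of_nontrivial s
      rwa [h w hw.ne'] at hw
  obtain ⟨K, hK, hv, ha⟩ := L.exists_bundle (u := s) (v := t)
    (fun y hy hay hby => by
      have := L.isTwoTerminalSP_component y hy.1 hy.2
      rwa [hay, hby] at this) hne
  convert hK
  symm
  ext p q
  · simp only [hv, SimpleGraph.Subgraph.verts_top, Set.mem_univ, iff_true]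
    by_cases h₁ : p = s
    · exact Or.inl h₁
    by_cases h₂ : p = t
    · exact Or.inr (Or.inl h₂)
    exact Or.inr (Or.inr (L.exists_root h₁ h₂))
  · simp only [ha, SimpleGraph.Subgraph.top_adj]
    constructor
    · rintro (h | ⟨y, -, -, -, h⟩)
      · exact h.1
      · exact h.1
    · intro h
      rcases L.edge p q h with h' | h' | ⟨h₁, h₂, h'⟩ | ⟨h₁, h₂, h'⟩
      · exact Or.inl ⟨h, Or.inl h'⟩
      · exact Or.inl ⟨h, Or.inr h'⟩
      · obtain ⟨y, hy, hay, hby, hd⟩ := L.exists_root h₁ h₂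
        exact Or.inr ⟨y, hy, hay, hby, h, Or.inl ⟨hd, h'⟩⟩
      · obtain ⟨y, hy, hay, hby, hd⟩ := L.exists_root h₁ h₂
        exact Or.inr ⟨y, hy, hay, hby, h, Or.inr ⟨hd, h'⟩⟩

end SPLabelling

/-! ### 2-connectivity of series-parallel graphs -/

/-- `x` and `y` are joined by a path of `H` that avoids `c`. -/
def ReachAvoiding {V : Type*} {G : SimpleGraph V} (H : G.Subgraph) (c x y : V) : Prop :=
  ReflTransGen (fun u v => H.Adj u v ∧ u ≠ c ∧ v ≠ c) x y

namespace ReachAvoiding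

variable {V : Type*} {G : SimpleGraph V} {H K : G.Subgraph} {c x y z : V}

theorem mono (h : ReachAvoiding H c x y) (hHK : H ≤ K) : ReachAvoiding K c x y :=
  ReflTransGen.mono (fun _ _ h => ⟨hHK.2 h.1, h.2⟩) _ _ h

theorem symm (h : ReachAvoiding H c x y) : ReachAvoiding H c y x := by
  induction h with
  | refl => exact .refl
  | tail _ h ih => exact ReflTransGen.head ⟨h.1.symm, h.2.2, h.2.1⟩ ih

theorem trans (h : ReachAvoiding H c x y) (h' : ReachAvoiding H c y z) : ReachAvoiding H c x z :=
  ReflTransGen.trans h h'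

theorem of_connected (hH : H.Connected) (hc : c ∉ H.verts) (hx : x ∈ H.verts) (hy : y ∈ H.verts) :
    ReachAvoiding H c x y := by
  obtain ⟨p⟩ := hH.preconnected ⟨x, hx⟩ ⟨y, hy⟩
  have key : ∀ u v : H.verts, H.coe.Walk u v → ReachAvoiding H c u v := by
    intro u v p
    induction p with
    | nil => exact .refl
    | @cons u v w h p ih =>
      exact ReflTransGen.head
        ⟨h, fun h => hc (h ▸ u.2), fun h => hc (h ▸ v.2)⟩ ih
  exact key _ _ p

theorem reachable (h : ReachAvoiding H c x y) (hx : x ≠ c) (hy : y ≠ c) :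
    (G.induce ({c}ᶜ : Set V)).Reachable ⟨x, hx⟩ ⟨y, hy⟩ := by
  induction h using ReflTransGen.head_induction_on with
  | refl => exact .refl _
  | @head u v h h' ih =>
    refine SimpleGraph.Reachable.trans (v := ⟨v, h.2.2⟩) ?_ (ih h.2.2)
    exact SimpleGraph.Adj.reachable (by simpa using h.1.adj_sub)

end ReachAvoiding

/-- After the deletion of a vertex, every vertex is still joined to a terminal. -/
theorem IsTwoTerminalSP.reachAvoiding_terminal {V : Type*} {G : SimpleGraph V} {H : G.Subgraph}
    {s t : V} (h : IsTwoTerminalSP G H s t) (c : V) :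
    ∀ x ∈ H.verts, x ≠ c → (s ≠ c ∧ ReachAvoiding H c x s) ∨ (t ≠ c ∧ ReachAvoiding H c x t) := by
  induction h with
  | @edge s t h =>
    intro x hx hxc
    rcases hx with rfl | rfl
    · exact Or.inl ⟨hxc, .refl⟩
    · exact Or.inr ⟨hxc, .refl⟩
  | @series H₁ H₂ s m t h₁ h₂ hv ih₁ ih₂ =>
    have hm : ∀ z, z ∈ H₁.verts → z ∈ H₂.verts → z = m := fun z hz hz' => by
      have : z ∈ H₁.verts ∩ H₂.verts := ⟨hz, hz'⟩
      rwa [hv] at this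
    rintro x (hx | hx) hxc
    · rcases ih₁ x hx hxc with ⟨h, hr⟩ | ⟨h, hr⟩
      · exact Or.inl ⟨h, hr.mono le_sup_left⟩
      -- Here `c` is not the middle vertex, so one of the two parts misses it; that part is
      -- connected and can be crossed entirely.
      · by_cases hc : c ∈ H₂.verts
        · have hc' : c ∉ H₁.verts := fun hc' => h (hm c hc' hc).symm
          exact Or.inl ⟨fun h => hc' (h ▸ h₁.source_mem),
            (ReachAvoiding.of_connected h₁.connected hc' hx h₁.source_mem).mono le_sup_left⟩
        · exact Or.inr ⟨fun h => hc (h ▸ h₂.sink_mem), (hr.mono le_sup_left).trans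
            ((ReachAvoiding.of_connected h₂.connected hc h₂.source_mem h₂.sink_mem).mono
              le_sup_right)⟩
    · rcases ih₂ x hx hxc with ⟨h, hr⟩ | ⟨h, hr⟩
      · by_cases hc : c ∈ H₁.verts
        · have hc' : c ∉ H₂.verts := fun hc' => h (hm c hc hc').symm
          exact Or.inr ⟨fun h => hc' (h ▸ h₂.sink_mem),
            (ReachAvoiding.of_connected h₂.connected hc' hx h₂.sink_mem).mono le_sup_right⟩
        · exact Or.inl ⟨fun h => hc (h ▸ h₁.source_mem), (hr.mono le_sup_right).trans
            ((ReachAvoiding.of_connected h₁.connected hc h₁.sink_mem h₁.source_mem).mono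
              le_sup_left)⟩
      · exact Or.inr ⟨h, hr.mono le_sup_right⟩
  | @parallel H₁ H₂ s t h₁ h₂ hv he ih₁ ih₂ =>
    rintro x (hx | hx) hxc
    · exact (ih₁ x hx hxc).imp (fun h => ⟨h.1, h.2.mono le_sup_left⟩)
        (fun h => ⟨h.1, h.2.mono le_sup_left⟩)
    · exact (ih₂ x hx hxc).imp (fun h => ⟨h.1, h.2.mono le_sup_right⟩)
        (fun h => ⟨h.1, h.2.mono le_sup_right⟩)

/-- Every remaining vertex reaches a remaining terminal, so it is enough that the terminals stay
joined when neither of them is deleted. -/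
theorem IsTwoTerminalSP.isTwoConnected {V : Type*} {G : SimpleGraph V} {s t : V}
    (hG : G.Connected) (h : IsTwoTerminalSP G ⊤ s t)
    (hst : ∀ c, c ≠ s → c ≠ t → ReachAvoiding (⊤ : G.Subgraph) c s t) : IsTwoConnected G := by
  refine ⟨hG, fun c hc => hc ?_⟩
  rintro ⟨x, hx⟩ ⟨y, hy⟩
  suffices ReachAvoiding (⊤ : G.Subgraph) c x y from this.reachable hx hy
  have hx' := h.reachAvoiding_terminal c x (by simp) hx
  have hy' := h.reachAvoiding_terminal c y (by simp) hy
  by_cases hs : s = c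
  · have h₁ := hx'.resolve_left (fun h => h.1 hs)
    have h₂ := hy'.resolve_left (fun h => h.1 hs)
    exact h₁.2.trans h₂.2.symm
  by_cases ht : t = c
  · have h₁ := hx'.resolve_right (fun h => h.1 ht)
    have h₂ := hy'.resolve_right (fun h => h.1 ht)
    exact h₁.2.trans h₂.2.symm
  have hst := hst c (Ne.symm hs) (Ne.symm ht)
  rcases hx' with ⟨-, h₁⟩ | ⟨-, h₁⟩ <;> rcases hy' with ⟨-, h₂⟩ | ⟨-, h₂⟩
  · exact h₁.trans h₂.symm
  · exact h₁.trans (hst.trans h₂.symm)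
  · exact h₁.trans (hst.symm.trans h₂.symm)
  · exact h₁.trans h₂.symm

/-- A labelling whose root is the edge `st` or has two components shows that the graph is
2-connected and series-parallel. -/
theorem SPLabelling.twoConnectedSeriesParallel {V : Type} [Finite V] {G : SimpleGraph V} {s t : V}
    {a b : V → V} {τ : V → ℕ} (L : SPLabelling G s t a b τ) (hG : G.Connected)
    (hroot : G.Adj s t ∨ ∃ x y, x ≠ y ∧ (x ≠ s ∧ x ≠ t ∧ a x = s ∧ b x = t) ∧
      (y ≠ s ∧ y ≠ t ∧ a y = s ∧ b y = t)) : twoConnectedSeriesParallel V G := by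
  have hsp := L.isTwoTerminalSP_top hG
  refine ⟨hsp.isTwoConnected hG fun c hcs hct => ?_, s, t, hsp⟩
  rcases hroot with h | ⟨x, y, hxy, ⟨hxs, hxt, hax, hbx⟩, ⟨hys, hyt, hay, hby⟩⟩
  · exact .single ⟨h, hcs.symm, hct.symm⟩
  · have hx := L.isTwoTerminalSP_component x hxs hxt
    have hy := L.isTwoTerminalSP_component y hys hyt
    have hi := L.component_inter ⟨hxs, hxt⟩ ⟨hys, hyt⟩ (hax.trans hay.symm) (hbx.trans hby.symm) hxy
    rw [hax, hbx] at hx hi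
    rw [hay, hby] at hy
    -- The two components share only the terminals, so one of them misses `c` and joins `s` to `t`.
    by_cases hc : c ∈ (component G s t a b τ x).verts
    · have hc' : c ∉ (component G s t a b τ y).verts := fun hc' => by
        rcases hi ⟨hc, hc'⟩ with h | h
        · exact hcs h
        · exact hct h
      exact (ReachAvoiding.of_connected hy.connected hc' hy.source_mem hy.sink_mem).mono le_top
    · exact (ReachAvoiding.of_connected hx.connected hc hx.source_mem hx.sink_mem).mono le_top

/-! ### Schemes: series pairs with two items of remote information per vertex -/

theorem IsTwoTerminalSP.symm {V : Type*} {G : SimpleGraph V} {H : G.Subgraph} {s t : V}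
    (h : IsTwoTerminalSP G H s t) : IsTwoTerminalSP G H t s := by
  induction h with
  | @edge s t h =>
    have : G.subgraphOfAdj h = G.subgraphOfAdj h.symm := SimpleGraph.subgraphOfAdj_symm h |>.symm
    rw [this]
    exact .edge h.symm
  | @series H₁ H₂ s m t h₁ h₂ hv ih₁ ih₂ =>
    rw [sup_comm]
    exact .series ih₂ ih₁ (by rwa [Set.inter_comm])
  | @parallel H₁ H₂ s t h₁ h₂ hv he ih₁ ih₂ =>
    exact .parallel ih₁ ih₂ (by rwa [Set.pair_comm t s]) he

/-- Every vertex `x` has a pair `(left x, right x)`, a depth, a vertex `parent x` from which it is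
reached, and a vertex `transit x` of which it forwards the label (itself if there is none). -/
structure Scheme (V : Type*) where
  left : V → V
  right : V → V
  parent : V → V
  transit : V → V
  depth : V → ℕ

/-- `x` is a vertex of `H` other than the terminals. -/
def Inner {V : Type*} {G : SimpleGraph V} (H : G.Subgraph) (s t x : V) : Prop :=
  x ∈ H.verts ∧ x ≠ s ∧ x ≠ t

namespace Scheme

variable {V : Type*} {G : SimpleGraph V}

/-- The label of `w` can be forwarded to `x` inside `H`. -/
def Forwards (D : Scheme V) (H : G.Subgraph) (s t w x : V) : Prop :=
  ∃ P : G.Subgraph, P ≤ H ∧ P.Connected ∧ x ∈ P.verts ∧ w ∈ P.verts ∧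
    ∀ y ∈ P.verts, y = w ∨ (Inner H s t y ∧ (D.parent y = w ∨ D.transit y = w))

/-- The scheme describes `H` with terminals `s`, `t`; the vertices with pair `(s, t)` have parent
`z`. -/
structure Describes (D : Scheme V) (H : G.Subgraph) (s t z : V) : Prop where
  ne : s ≠ t
  pair : ∀ x, Inner H s t x → (D.left x = s ∧ D.right x = t ∧ D.parent x = z) ∨
    (Inner H s t (D.parent x) ∧ D.depth (D.parent x) < D.depth x ∧
      ((D.right x = D.parent x ∧ D.left x = D.left (D.parent x)) ∨
        (D.left x = D.parent x ∧ D.right x = D.right (D.parent x))))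
  edge : ∀ u v, H.Adj u v → (u = s ∧ v = t) ∨ (u = t ∧ v = s) ∨
    (Inner H s t v ∧ (u = D.left v ∨ u = D.right v)) ∨
    (Inner H s t u ∧ (v = D.left u ∨ v = D.right u))
  left : ∀ x, Inner H s t x → ∃ y, H.Adj x y ∧ (y = D.left x ∨ (Inner H s t y ∧ D.right y = x))
  right : ∀ x, Inner H s t x → ∃ y, H.Adj x y ∧ (y = D.right x ∨ (Inner H s t y ∧ D.left y = x))
  sink : ∃ y, H.Adj t y ∧ (y = s ∨ (Inner H s t y ∧ D.right y = t))
  source : ∃ y, H.Adj s y ∧ (y = t ∨ (Inner H s t y ∧ D.left y = s))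
  known : ∀ x, Inner H s t x → D.Forwards H s t (D.parent x) x
  forwarded : ∀ x, Inner H s t x → D.transit x ≠ x → D.Forwards H s t (D.transit x) x

/-- The subgraph `P` joins `s` to `t` in `H` and its vertices do not forward any label yet. -/
structure Free (D : Scheme V) (H : G.Subgraph) (s t : V) (P : G.Subgraph) : Prop where
  le : P ≤ H
  connected : P.Connected
  source_mem : s ∈ P.verts
  sink_mem : t ∈ P.verts
  transit : ∀ y ∈ P.verts, y ≠ s → y ≠ t → D.transit y = y

/-- `x` is the middle of a series composition with terminals `s`, `t`. -/
def Root (D : Scheme V) (H : G.Subgraph) (s t x : V) : Prop :=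
  Inner H s t x ∧ D.left x = s ∧ D.right x = t

/-- The scheme with the roles of the source and the sink exchanged. -/
def swap (D : Scheme V) : Scheme V where
  left := D.right
  right := D.left
  parent := D.parent
  transit := D.transit
  depth := D.depth

theorem inner_swap {H : G.Subgraph} {s t x : V} : Inner H t s x ↔ Inner H s t x := by
  unfold Inner
  tauto

theorem Describes.swap {D : Scheme V} {H : G.Subgraph} {s t z : V} (h : D.Describes H s t z) :
    D.swap.Describes H t s z where
  ne := h.ne.symm
  pair x hx := by
    have := h.pair x (inner_swap.1 hx)
    rw [inner_swap]
    simp only [Scheme.swap]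
    tauto
  edge u v huv := by
    have := h.edge u v huv
    rw [inner_swap (x := u), inner_swap (x := v)]
    simp only [Scheme.swap]
    tauto
  left x hx := by
    obtain ⟨y, hy, hy'⟩ := h.right x (inner_swap.1 hx)
    exact ⟨y, hy, by rwa [inner_swap]⟩
  right x hx := by
    obtain ⟨y, hy, hy'⟩ := h.left x (inner_swap.1 hx)
    exact ⟨y, hy, by rwa [inner_swap]⟩
  sink := by
    obtain ⟨y, hy, hy'⟩ := h.source
    exact ⟨y, hy, by rwa [inner_swap]⟩
  source := by
    obtain ⟨y, hy, hy'⟩ := h.sink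
    exact ⟨y, hy, by rwa [inner_swap]⟩
  known x hx := by
    have := h.known x (inner_swap.1 hx)
    simp only [Forwards, inner_swap] at this ⊢
    exact this
  forwarded x hx := by
    have := h.forwarded x (inner_swap.1 hx)
    simp only [Forwards, inner_swap] at this ⊢
    exact this

theorem Free.swap {D : Scheme V} {H : G.Subgraph} {s t : V} {P : G.Subgraph} (h : D.Free H s t P) :
    D.swap.Free H t s P where
  le := h.le
  connected := h.connected
  source_mem := h.sink_mem
  sink_mem := h.source_mem
  transit y hy h₁ h₂ := h.transit y hy h₂ h₁

theorem Root.swap {D : Scheme V} {H : G.Subgraph} {s t x : V} (h : D.Root H s t x) :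
    D.swap.Root H t s x :=
  ⟨inner_swap.2 h.1, h.2.2, h.2.1⟩

theorem Describes.source_mem {D : Scheme V} {H : G.Subgraph} {s t z : V}
    (h : D.Describes H s t z) : s ∈ H.verts := by
  obtain ⟨y, hy, -⟩ := h.source
  exact hy.fst_mem

theorem Describes.sink_mem {D : Scheme V} {H : G.Subgraph} {s t z : V}
    (h : D.Describes H s t z) : t ∈ H.verts := h.swap.source_mem

/-- `D` extends the scheme `D₀` for a part `H₀` of `H`, except for new forwarded labels. -/
structure Extends (D D₀ : Scheme V) (H₀ : G.Subgraph) (s₀ t₀ : V) (H : G.Subgraph) (s t : V) :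
    Prop where
  le : H₀ ≤ H
  inner : ∀ x, Inner H₀ s₀ t₀ x → Inner H s t x
  left : ∀ x, Inner H₀ s₀ t₀ x → D.left x = D₀.left x
  right : ∀ x, Inner H₀ s₀ t₀ x → D.right x = D₀.right x
  parent : ∀ x, Inner H₀ s₀ t₀ x → D.parent x = D₀.parent x
  transit : ∀ x, Inner H₀ s₀ t₀ x → D.transit x = D₀.transit x ∨ D₀.transit x = x
  depth : ∀ x y, Inner H₀ s₀ t₀ x → Inner H₀ s₀ t₀ y → D₀.depth x < D₀.depth y →
    D.depth x < D.depth y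

namespace Extends

variable {D D₀ : Scheme V} {H₀ H : G.Subgraph} {s₀ t₀ s t z₀ : V}

theorem exists_left (E : D.Extends D₀ H₀ s₀ t₀ H s t) (h : D₀.Describes H₀ s₀ t₀ z₀) {x : V}
    (hx : Inner H₀ s₀ t₀ x) :
    ∃ y, H.Adj x y ∧ (y = D.left x ∨ (Inner H s t y ∧ D.right y = x)) := by
  obtain ⟨y, hy, hy'⟩ := h.left x hx
  refine ⟨y, E.le.2 hy, ?_⟩
  rw [E.left x hx]
  exact hy'.imp_right fun h => ⟨E.inner y h.1, by rw [E.right y h.1, h.2]⟩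

theorem exists_right (E : D.Extends D₀ H₀ s₀ t₀ H s t) (h : D₀.Describes H₀ s₀ t₀ z₀) {x : V}
    (hx : Inner H₀ s₀ t₀ x) :
    ∃ y, H.Adj x y ∧ (y = D.right x ∨ (Inner H s t y ∧ D.left y = x)) := by
  obtain ⟨y, hy, hy'⟩ := h.right x hx
  refine ⟨y, E.le.2 hy, ?_⟩
  rw [E.right x hx]
  exact hy'.imp_right fun h => ⟨E.inner y h.1, by rw [E.left y h.1, h.2]⟩

/-- New transit duties fall only on vertices that were idle, that is, had themselves as transit.
Such a vertex helped to forward `w` only through its parent or by being `w`, so old routes survive.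
-/
theorem forwards (E : D.Extends D₀ H₀ s₀ t₀ H s t) {w x : V} (h : D₀.Forwards H₀ s₀ t₀ w x) :
    D.Forwards H s t w x := by
  obtain ⟨P, hP, hc, hx, hw, hy⟩ := h
  refine ⟨P, hP.trans E.le, hc, hx, hw, fun y hyP => ?_⟩
  rcases hy y hyP with h | ⟨h, h'⟩
  · exact Or.inl h
  · rw [E.parent y h]
    rcases h' with h' | h'
    · exact Or.inr ⟨E.inner y h, Or.inl h'⟩
    · rcases E.transit y h with h'' | h''
      · exact Or.inr ⟨E.inner y h, Or.inr (h''.trans h')⟩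
      · exact Or.inl (h''.symm.trans h')

theorem known (E : D.Extends D₀ H₀ s₀ t₀ H s t) (h : D₀.Describes H₀ s₀ t₀ z₀) {x : V}
    (hx : Inner H₀ s₀ t₀ x) : D.Forwards H s t (D.parent x) x := by
  rw [E.parent x hx]
  exact E.forwards (h.known x hx)

theorem pair (E : D.Extends D₀ H₀ s₀ t₀ H s t) (h : D₀.Describes H₀ s₀ t₀ z₀) {x : V}
    (hx : Inner H₀ s₀ t₀ x) : (D.left x = s₀ ∧ D.right x = t₀ ∧ D.parent x = z₀) ∨
    (Inner H s t (D.parent x) ∧ D.depth (D.parent x) < D.depth x ∧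
      ((D.right x = D.parent x ∧ D.left x = D.left (D.parent x)) ∨
        (D.left x = D.parent x ∧ D.right x = D.right (D.parent x)))) := by
  rw [E.left x hx, E.right x hx, E.parent x hx]
  refine (h.pair x hx).imp_right fun ⟨h₁, h₂, h₃⟩ => ?_
  rw [E.left _ h₁, E.right _ h₁]
  exact ⟨E.inner _ h₁, E.depth _ _ h₁ hx h₂, h₃⟩

theorem edge (E : D.Extends D₀ H₀ s₀ t₀ H s t) (h : D₀.Describes H₀ s₀ t₀ z₀) {u v : V}
    (huv : H₀.Adj u v) : (u = s₀ ∧ v = t₀) ∨ (u = t₀ ∧ v = s₀) ∨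
    (Inner H s t v ∧ (u = D.left v ∨ u = D.right v)) ∨
    (Inner H s t u ∧ (v = D.left u ∨ v = D.right u)) := by
  rcases h.edge u v huv with h | h | ⟨h, h'⟩ | ⟨h, h'⟩
  · exact Or.inl h
  · exact Or.inr (Or.inl h)
  · rw [← E.left v h, ← E.right v h] at h'
    exact Or.inr (Or.inr (Or.inl ⟨E.inner v h, h'⟩))
  · rw [← E.left u h, ← E.right u h] at h'
    exact Or.inr (Or.inr (Or.inr ⟨E.inner u h, h'⟩))

end Extends

end Scheme

open Scheme

variable {V : Type*} {G : SimpleGraph V}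

/-- `H` has a scheme with one free connection between the terminals. -/
def HasScheme (H : G.Subgraph) (s t z : V) : Prop :=
  ∃ D : Scheme V, D.Describes H s t z ∧ (∃ P, D.Free H s t P) ∧ (H.Adj s t ∨ ∃ x, D.Root H s t x)

/-- `H` has a scheme with two independent free connections between the terminals. -/
def HasDoubleScheme (H : G.Subgraph) (s t z : V) : Prop :=
  ∃ D : Scheme V, D.Describes H s t z ∧
    (∃ P Q, D.Free H s t P ∧ D.Free H s t Q ∧ P.verts ∩ Q.verts ⊆ {s, t}) ∧
    (H.Adj s t ∨ ∃ x y, x ≠ y ∧ D.Root H s t x ∧ D.Root H s t y)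

theorem HasDoubleScheme.hasScheme {H : G.Subgraph} {s t z : V} (h : HasDoubleScheme H s t z) :
    HasScheme H s t z := by
  obtain ⟨D, hD, ⟨P, -, hP, -⟩, h⟩ := h
  exact ⟨D, hD, ⟨P, hP⟩, h.imp_right fun ⟨x, _, _, hx, _⟩ => ⟨x, hx⟩⟩

theorem HasScheme.swap {H : G.Subgraph} {s t z : V} (h : HasScheme H s t z) :
    HasScheme H t s z := by
  obtain ⟨D, hD, ⟨P, hP⟩, h⟩ := h
  exact ⟨D.swap, hD.swap, ⟨P, hP.swap⟩, h.imp (fun h => h.symm) fun ⟨x, hx⟩ => ⟨x, hx.swap⟩⟩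

theorem HasDoubleScheme.swap {H : G.Subgraph} {s t z : V} (h : HasDoubleScheme H s t z) :
    HasDoubleScheme H t s z := by
  obtain ⟨D, hD, ⟨P, Q, hP, hQ, hPQ⟩, h⟩ := h
  exact ⟨D.swap, hD.swap, ⟨P, Q, hP.swap, hQ.swap, by rwa [Set.pair_comm]⟩,
    h.imp (fun h => h.symm) fun ⟨x, y, hxy, hx, hy⟩ => ⟨x, y, hxy, hx.swap, hy.swap⟩⟩

/-! ### Schemes for edges, parallel compositions and series compositions -/

theorem hasDoubleScheme_edge {s t : V} (h : G.Adj s t) (z : V) :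
    HasDoubleScheme (G.subgraphOfAdj h) s t z := by
  have hI : ∀ x, ¬ Inner (G.subgraphOfAdj h) s t x := by
    rintro x ⟨hx, h₁, h₂⟩
    rcases hx with hx | hx
    · exact h₁ hx
    · exact h₂ hx
  have hadj : (G.subgraphOfAdj h).Adj s t := by simp
  refine ⟨⟨id, id, id, id, fun _ => 0⟩, ⟨h.ne, fun x hx => absurd hx (hI x), fun u v huv => ?_,
    fun x hx => absurd hx (hI x), fun x hx => absurd hx (hI x), ⟨s, hadj.symm, Or.inl rfl⟩,
    ⟨t, hadj, Or.inl rfl⟩, fun x hx => absurd hx (hI x), fun x hx => absurd hx (hI x)⟩,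
    -- An edge has no inner vertex, so it serves as both independent connections.
    ⟨G.subgraphOfAdj h, G.subgraphOfAdj h, ?_, ?_, ?_⟩, Or.inl hadj⟩
  · rw [SimpleGraph.subgraphOfAdj_adj, Sym2.eq_iff] at huv
    rcases huv with ⟨rfl, rfl⟩ | ⟨rfl, rfl⟩ <;> simp
  · exact ⟨le_rfl, SimpleGraph.Subgraph.subgraphOfAdj_connected h, by simp, by simp,
      fun _ _ _ _ => rfl⟩
  · exact ⟨le_rfl, SimpleGraph.Subgraph.subgraphOfAdj_connected h, by simp, by simp,
      fun _ _ _ _ => rfl⟩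
  · exact Set.inter_subset_left

/-- Each side contributes its free connection, and the two are independent because the sides share
only the terminals. -/
theorem HasScheme.parallel {A B : G.Subgraph} {s t z : V} (hA : HasScheme A s t z)
    (hB : HasScheme B s t z) (hv : A.verts ∩ B.verts = {s, t}) :
    HasDoubleScheme (A ⊔ B) s t z := by
  classical
  obtain ⟨DA, hA, ⟨P, hP⟩, rA⟩ := hA
  obtain ⟨DB, hB, ⟨Q, hQ⟩, rB⟩ := hB
  have hBA : ∀ x, Inner B s t x → x ∉ A.verts := fun x hx hxA => by
    have : x ∈ A.verts ∩ B.verts := ⟨hxA, hx.1⟩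
    rw [hv] at this
    rcases this with h | h
    · exact hx.2.1 h
    · exact hx.2.2 h
  let D : Scheme V :=
    { left := fun x => if x ∈ A.verts then DA.left x else DB.left x
      right := fun x => if x ∈ A.verts then DA.right x else DB.right x
      parent := fun x => if x ∈ A.verts then DA.parent x else DB.parent x
      transit := fun x => if x ∈ A.verts then DA.transit x else DB.transit x
      depth := fun x => if x ∈ A.verts then DA.depth x else DB.depth x }
  have tA : ∀ x, Inner A s t x → D.transit x = DA.transit x := fun x hx => if_pos hx.1
  have tB : ∀ x, Inner B s t x → D.transit x = DB.transit x := fun x hx => if_neg (hBA x hx)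
  have EA : D.Extends DA A s t (A ⊔ B) s t :=
    { le := le_sup_left
      inner := fun x hx => ⟨Or.inl hx.1, hx.2⟩
      left := fun x hx => if_pos hx.1
      right := fun x hx => if_pos hx.1
      parent := fun x hx => if_pos hx.1
      transit := fun x hx => Or.inl (tA x hx)
      depth := fun x y hx hy h => by
        change (if _ then _ else _) < (if _ then _ else _)
        rwa [if_pos hx.1, if_pos hy.1] }
  have EB : D.Extends DB B s t (A ⊔ B) s t :=
    { le := le_sup_right
      inner := fun x hx => ⟨Or.inr hx.1, hx.2⟩
      left := fun x hx => if_neg (hBA x hx)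
      right := fun x hx => if_neg (hBA x hx)
      parent := fun x hx => if_neg (hBA x hx)
      transit := fun x hx => Or.inl (tB x hx)
      depth := fun x y hx hy h => by
        change (if _ then _ else _) < (if _ then _ else _)
        rwa [if_neg (hBA x hx), if_neg (hBA y hy)] }
  have hI : ∀ x, Inner (A ⊔ B) s t x → Inner A s t x ∨ Inner B s t x := by
    rintro x ⟨hx | hx, h⟩
    · exact Or.inl ⟨hx, h⟩
    · exact Or.inr ⟨hx, h⟩
  refine ⟨D, ⟨hA.ne, fun x hx => ?_, ?_, fun x hx => ?_, fun x hx => ?_, ?_, ?_, fun x hx => ?_,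
    fun x hx => ?_⟩, ⟨P, Q, ?_, ?_, ?_⟩, ?_⟩
  · exact (hI x hx).elim (EA.pair hA) (EB.pair hB)
  · rintro u v (huv | huv)
    · exact EA.edge hA huv
    · exact EB.edge hB huv
  · exact (hI x hx).elim (EA.exists_left hA) (EB.exists_left hB)
  · exact (hI x hx).elim (EA.exists_right hA) (EB.exists_right hB)
  · obtain ⟨y, hy, h⟩ := hA.sink
    exact ⟨y, Or.inl hy, h.imp_right fun h => ⟨EA.inner y h.1, by rw [EA.right y h.1, h.2]⟩⟩
  · obtain ⟨y, hy, h⟩ := hA.source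
    exact ⟨y, Or.inl hy, h.imp_right fun h => ⟨EA.inner y h.1, by rw [EA.left y h.1, h.2]⟩⟩
  · exact (hI x hx).elim (EA.known hA) (EB.known hB)
  · rcases hI x hx with h | h
    · rw [tA x h]
      exact fun h' => EA.forwards (hA.forwarded x h h')
    · rw [tB x h]
      exact fun h' => EB.forwards (hB.forwarded x h h')
  · exact ⟨hP.le.trans le_sup_left, hP.connected, hP.source_mem, hP.sink_mem, fun y hy h₁ h₂ => by
      rw [tA y ⟨hP.le.1 hy, h₁, h₂⟩]
      exact hP.transit y hy h₁ h₂⟩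
  · exact ⟨hQ.le.trans le_sup_right, hQ.connected, hQ.source_mem, hQ.sink_mem, fun y hy h₁ h₂ => by
      rw [tB y ⟨hQ.le.1 hy, h₁, h₂⟩]
      exact hQ.transit y hy h₁ h₂⟩
  · rw [← hv]
    exact Set.inter_subset_inter hP.le.1 hQ.le.1
  · rcases rA with h | ⟨x, hx, hx₁, hx₂⟩
    · exact Or.inl (Or.inl h)
    rcases rB with h | ⟨y, hy, hy₁, hy₂⟩
    · exact Or.inl (Or.inr h)
    refine Or.inr ⟨x, y, ?_, ⟨EA.inner x hx, ?_, ?_⟩, ⟨EB.inner y hy, ?_, ?_⟩⟩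
    · rintro rfl
      exact hBA x hy hx.1
    · rw [EA.left x hx, hx₁]
    · rw [EA.right x hx, hx₂]
    · rw [EB.left y hy, hy₁]
    · rw [EB.right y hy, hy₂]

/-- The parent of vertices with pair `(s, m)` or `(m, t)` is the middle `m`, hence the last argument
`m` on both sides. The vertex `m` itself gets parent `s`, whose label must travel to it through `A`.
This uses up the free connection `P` of `A`; the second one, `R`, prolonged by the free connection
`Q` of `B`, remains free. This is why `A` needs two. -/
theorem HasDoubleScheme.series {A B : G.Subgraph} {s m t : V} (hA : HasDoubleScheme A s m m)
    (hB : HasScheme B m t m) (hv : A.verts ∩ B.verts = {m}) : HasScheme (A ⊔ B) s t s := by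
  classical
  obtain ⟨DA, hA, ⟨P, R, hP, hR, hPR⟩, -⟩ := hA
  obtain ⟨DB, hB, ⟨Q, hQ⟩, -⟩ := hB
  have hAB : ∀ x, x ∈ A.verts → x ∈ B.verts → x = m := fun x hx hx' => by
    have : x ∈ A.verts ∩ B.verts := ⟨hx, hx'⟩
    rwa [hv] at this
  have hsB : s ∉ B.verts := fun h => hA.ne (hAB s hA.source_mem h)
  have htA : t ∉ A.verts := fun h => hB.ne (hAB t h hB.sink_mem).symm
  have hst : s ≠ t := fun h => htA (h ▸ hA.source_mem)
  have hBA : ∀ x, Inner B m t x → x ∉ A.verts := fun x hx hxA => hx.2.1 (hAB x hxA hx.1)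
  let D : Scheme V :=
    { left := fun x => if x = m then s else if x ∈ A.verts then DA.left x else DB.left x
      right := fun x => if x = m then t else if x ∈ A.verts then DA.right x else DB.right x
      parent := fun x => if x = m then s else if x ∈ A.verts then DA.parent x else DB.parent x
      transit := fun x => if x = m then m else if x ∈ P.verts then s else
        if x ∈ A.verts then DA.transit x else DB.transit x
      depth := fun x => if x = m then 0 else
        if x ∈ A.verts then DA.depth x + 1 else DB.depth x + 1 }
  have lm : D.left m = s := if_pos rfl
  have rm : D.right m = t := if_pos rfl
  have pm : D.parent m = s := if_pos rfl
  have tm : D.transit m = m := if_pos rfl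
  have dm : D.depth m = 0 := if_pos rfl
  have dA : ∀ x, Inner A s m x → D.depth x = DA.depth x + 1 := fun x hx => by
    simp only [D, if_neg hx.2.2, if_pos hx.1]
  have dB : ∀ x, Inner B m t x → D.depth x = DB.depth x + 1 := fun x hx => by
    simp only [D, if_neg hx.2.1, if_neg (hBA x hx)]
  have tP : ∀ x, Inner A s m x → x ∈ P.verts → D.transit x = s := fun x hx hxP => by
    simp only [D, if_neg hx.2.2, if_pos hxP]
  have tA : ∀ x, Inner A s m x → x ∉ P.verts → D.transit x = DA.transit x := fun x hx hxP => by
    simp only [D, if_neg hx.2.2, if_pos hx.1, if_neg hxP]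
  have tB : ∀ x, Inner B m t x → D.transit x = DB.transit x := fun x hx => by
    simp only [D, if_neg hx.2.1, if_neg (hBA x hx), if_neg fun h => hBA x hx (hP.le.1 h)]
  have hm : Inner (A ⊔ B) s t m := ⟨Or.inl hA.sink_mem, hA.ne.symm, hB.ne⟩
  have EA : D.Extends DA A s m (A ⊔ B) s t :=
    { le := le_sup_left
      inner := fun x hx => ⟨Or.inl hx.1, hx.2.1, fun h => htA (h ▸ hx.1)⟩
      left := fun x hx => by simp only [D, if_neg hx.2.2, if_pos hx.1]
      right := fun x hx => by simp only [D, if_neg hx.2.2, if_pos hx.1]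
      parent := fun x hx => by simp only [D, if_neg hx.2.2, if_pos hx.1]
      transit := fun x hx => by
        by_cases hxP : x ∈ P.verts
        · exact Or.inr (hP.transit x hxP hx.2.1 hx.2.2)
        · exact Or.inl (tA x hx hxP)
      depth := fun x y hx hy h => by
        rw [dA x hx, dA y hy]
        omega }
  have EB : D.Extends DB B m t (A ⊔ B) s t :=
    { le := le_sup_right
      inner := fun x hx => ⟨Or.inr hx.1, fun h => hsB (h ▸ hx.1), hx.2.2⟩
      left := fun x hx => by simp only [D, if_neg hx.2.1, if_neg (hBA x hx)]
      right := fun x hx => by simp only [D, if_neg hx.2.1, if_neg (hBA x hx)]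
      parent := fun x hx => by simp only [D, if_neg hx.2.1, if_neg (hBA x hx)]
      transit := fun x hx => Or.inl (tB x hx)
      depth := fun x y hx hy h => by
        rw [dB x hx, dB y hy]
        omega }
  have hI : ∀ x, Inner (A ⊔ B) s t x → x = m ∨ Inner A s m x ∨ Inner B m t x := by
    rintro x ⟨hx | hx, h⟩
    · by_cases hxm : x = m
      · exact Or.inl hxm
      · exact Or.inr (Or.inl ⟨hx, h.1, hxm⟩)
    · by_cases hxm : x = m
      · exact Or.inl hxm
      · exact Or.inr (Or.inr ⟨hx, hxm, h.2⟩)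
  -- Along `P` the label of `s` is the transit of the inner vertices and the parent label of `m`.
  have hPs : ∀ x ∈ P.verts, D.Forwards (A ⊔ B) s t s x := fun x hx => by
    refine ⟨P, hP.le.trans le_sup_left, hP.connected, hx, hP.source_mem, fun y hy => ?_⟩
    by_cases hys : y = s
    · exact Or.inl hys
    by_cases hym : y = m
    · subst hym
      exact Or.inr ⟨hm, Or.inl pm⟩
    · have hy' : Inner A s m y := ⟨hP.le.1 hy, hys, hym⟩
      exact Or.inr ⟨EA.inner y hy', Or.inr (tP y hy' hy)⟩
  have hleft : ∃ y, (A ⊔ B).Adj m y ∧ (y = s ∨ Inner (A ⊔ B) s t y ∧ D.right y = m) := by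
    obtain ⟨y, hy, h⟩ := hA.sink
    exact ⟨y, Or.inl hy, h.imp_right fun h => ⟨EA.inner y h.1, by rw [EA.right y h.1, h.2]⟩⟩
  have hright : ∃ y, (A ⊔ B).Adj m y ∧ (y = t ∨ Inner (A ⊔ B) s t y ∧ D.left y = m) := by
    obtain ⟨y, hy, h⟩ := hB.source
    exact ⟨y, Or.inr hy, h.imp_right fun h => ⟨EB.inner y h.1, by rw [EB.left y h.1, h.2]⟩⟩
  refine ⟨D, ⟨hst, fun x hx => ?_, ?_, fun x hx => ?_, fun x hx => ?_, ?_, ?_, fun x hx => ?_,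
    fun x hx => ?_⟩, ⟨R ⊔ Q, ?_⟩, Or.inr ⟨m, hm, lm, rm⟩⟩
  · rcases hI x hx with rfl | h | h
    · exact Or.inl ⟨lm, rm, pm⟩
    · refine Or.inr ((EA.pair hA h).elim ?_ id)
      rintro ⟨h₁, h₂, h₃⟩
      rw [h₃, dm, lm, dA x h]
      exact ⟨hm, by omega, Or.inl ⟨h₂, h₁⟩⟩
    · refine Or.inr ((EB.pair hB h).elim ?_ id)
      rintro ⟨h₁, h₂, h₃⟩
      rw [h₃, dm, rm, dB x h]
      exact ⟨hm, by omega, Or.inr ⟨h₁, h₂⟩⟩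
  · rintro u v (huv | huv)
    · rcases EA.edge hA huv with ⟨rfl, rfl⟩ | ⟨rfl, rfl⟩ | h
      · exact Or.inr (Or.inr (Or.inl ⟨hm, Or.inl lm.symm⟩))
      · exact Or.inr (Or.inr (Or.inr ⟨hm, Or.inl lm.symm⟩))
      · exact Or.inr (Or.inr h)
    · rcases EB.edge hB huv with ⟨rfl, rfl⟩ | ⟨rfl, rfl⟩ | h
      · exact Or.inr (Or.inr (Or.inr ⟨hm, Or.inr rm.symm⟩))
      · exact Or.inr (Or.inr (Or.inl ⟨hm, Or.inr rm.symm⟩))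
      · exact Or.inr (Or.inr h)
  · rcases hI x hx with rfl | h | h
    · rwa [lm]
    · exact EA.exists_left hA h
    · exact EB.exists_left hB h
  · rcases hI x hx with rfl | h | h
    · rwa [rm]
    · exact EA.exists_right hA h
    · exact EB.exists_right hB h
  · obtain ⟨y, hy, rfl | h⟩ := hB.sink
    · exact ⟨y, Or.inr hy, Or.inr ⟨hm, rm⟩⟩
    · exact ⟨y, Or.inr hy, Or.inr ⟨EB.inner y h.1, by rw [EB.right y h.1, h.2]⟩⟩
  · obtain ⟨y, hy, rfl | h⟩ := hA.source
    · exact ⟨y, Or.inl hy, Or.inr ⟨hm, lm⟩⟩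
    · exact ⟨y, Or.inl hy, Or.inr ⟨EA.inner y h.1, by rw [EA.left y h.1, h.2]⟩⟩
  · rcases hI x hx with rfl | h | h
    · rw [pm]
      exact hPs _ hP.sink_mem
    · exact EA.known hA h
    · exact EB.known hB h
  · intro hxt
    rcases hI x hx with rfl | h | h
    · exact absurd tm hxt
    · by_cases hxP : x ∈ P.verts
      · rw [tP x h hxP]
        exact hPs x hxP
      · rw [tA x h hxP] at hxt ⊢
        exact EA.forwards (hA.forwarded x h hxt)
    · rw [tB x h] at hxt ⊢
      exact EB.forwards (hB.forwarded x h hxt)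
  · refine ⟨sup_le_sup hR.le hQ.le, SimpleGraph.Subgraph.connected_sup hR.connected.preconnected
      hQ.connected.preconnected ⟨m, hR.sink_mem, hQ.source_mem⟩, Or.inl hR.source_mem,
      Or.inr hQ.sink_mem, fun y hy hys hyt => ?_⟩
    by_cases hym : y = m
    · rw [hym, tm]
    rcases hy with hy | hy
    -- A vertex of `R` other than `s`, `m` is not on `P`, so it is still idle.
    · rw [tA y ⟨hR.le.1 hy, hys, hym⟩ fun h => ?_]
      · exact hR.transit y hy hys hym
      · rcases hPR ⟨h, hy⟩ with h | h
        · exact hys h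
        · exact hym h
    · rw [tB y ⟨hQ.le.1 hy, hym, hyt⟩]
      exact hQ.transit y hy hym hyt

/-- The statement proved by structural induction: besides schemes for `H` itself, one can put `H` in
series before and after a subgraph that has a scheme. -/
theorem IsTwoTerminalSP.hasScheme {H : G.Subgraph} {s t : V} (h : IsTwoTerminalSP G H s t) :
    (HasScheme H s t s ∧ HasScheme H s t t) ∧
    (∀ (B : G.Subgraph) (r : V), HasScheme B t r t → H.verts ∩ B.verts = {t} →
      HasScheme (H ⊔ B) s r s) ∧
    (∀ (B : G.Subgraph) (r : V), HasScheme B r s s → B.verts ∩ H.verts = {s} →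
      HasScheme (B ⊔ H) r t t) := by
  have double : ∀ (H : G.Subgraph) (s t : V), (∀ z, z = s ∨ z = t → HasDoubleScheme H s t z) →
      (HasScheme H s t s ∧ HasScheme H s t t) ∧
      (∀ (B : G.Subgraph) (r : V), HasScheme B t r t → H.verts ∩ B.verts = {t} →
        HasScheme (H ⊔ B) s r s) ∧
      (∀ (B : G.Subgraph) (r : V), HasScheme B r s s → B.verts ∩ H.verts = {s} →
        HasScheme (B ⊔ H) r t t) := by
    refine fun H s t h => ⟨⟨(h s (Or.inl rfl)).hasScheme, (h t (Or.inr rfl)).hasScheme⟩,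
      fun B r hB hv => (h t (Or.inr rfl)).series hB hv, fun B r hB hv => ?_⟩
    rw [sup_comm]
    exact ((h s (Or.inl rfl)).swap.series hB.swap (by rwa [Set.inter_comm])).swap
  induction h with
  | edge h => exact double _ _ _ fun z _ => hasDoubleScheme_edge h z
  | @series H₁ H₂ s m t h₁ h₂ hv ih₁ ih₂ =>
    have hm : ∀ {x}, x ∈ H₁.verts → x ∈ H₂.verts → x = m := fun {x} hx hx' => by
      have : x ∈ H₁.verts ∩ H₂.verts := ⟨hx, hx'⟩
      rwa [hv] at this
    -- Placing `H₁` before `H₂` makes the source the parent of the middle vertex; placing `H₂` after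
    -- `H₁` makes it the sink.
    refine ⟨⟨ih₁.2.1 H₂ t ih₂.1.1 hv, ih₂.2.2 H₁ s ih₁.1.2 hv⟩, fun B r hB hB' => ?_,
      fun B r hB hB' => ?_⟩
    · have ht : ∀ {x}, x ∈ H₁.verts ∨ x ∈ H₂.verts → x ∈ B.verts → x = t := fun {x} hx hx' => by
        have : x ∈ (H₁ ⊔ H₂).verts ∩ B.verts := ⟨hx, hx'⟩
        rwa [hB'] at this
      have htB : t ∈ B.verts := (hB'.ge rfl).2
      rw [sup_assoc]
      -- A series composition has only one free connection, so the chain is reassociated: factors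
      -- are added one at a time, until each one is an edge or a parallel composition and has a
      -- double scheme.
      refine ih₁.2.1 _ r (ih₂.2.1 B r hB ?_) ?_
      · ext x
        exact ⟨fun hx => ht (Or.inr hx.1) hx.2, by rintro rfl; exact ⟨h₂.sink_mem, htB⟩⟩
      · ext x
        constructor
        · rintro ⟨hx, hx' | hx'⟩
          · exact hm hx hx'
          · obtain rfl := ht (Or.inl hx) hx'
            exact hm hx h₂.sink_mem
        · rintro rfl
          exact ⟨h₁.sink_mem, Or.inl h₂.source_mem⟩
    · have hs : ∀ {x}, x ∈ B.verts → x ∈ H₁.verts ∨ x ∈ H₂.verts → x = s := fun {x} hx hx' => by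
        have : x ∈ B.verts ∩ (H₁ ⊔ H₂).verts := ⟨hx, hx'⟩
        rwa [hB'] at this
      have hsB : s ∈ B.verts := (hB'.ge rfl).1
      rw [← sup_assoc]
      refine ih₂.2.2 _ r (ih₁.2.2 B r hB ?_) ?_
      · ext x
        exact ⟨fun hx => hs hx.1 (Or.inl hx.2), by rintro rfl; exact ⟨hsB, h₁.source_mem⟩⟩
      · ext x
        constructor
        · rintro ⟨hx | hx, hx'⟩
          · obtain rfl := hs hx (Or.inr hx')
            exact hm h₁.source_mem hx'
          · exact hm hx hx'
        · rintro rfl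
          exact ⟨Or.inr h₁.sink_mem, h₂.source_mem⟩
  | @parallel H₁ H₂ s t h₁ h₂ hv he ih₁ ih₂ =>
    refine double _ _ _ ?_
    rintro z (rfl | rfl)
    · exact ih₁.1.1.parallel ih₂.1.1 hv
    · exact ih₁.1.2.parallel ih₂.1.2 hv

/-- A 2-connected series-parallel graph is an edge or a parallel composition. -/
theorem IsTwoTerminalSP.hasDoubleScheme {s t : V} (h : IsTwoTerminalSP G ⊤ s t)
    (hG : IsTwoConnected G) : HasDoubleScheme (⊤ : G.Subgraph) s t s := by
  generalize hK : (⊤ : G.Subgraph) = K at h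
  cases h with
  | edge h => exact hasDoubleScheme_edge h s
  | parallel h₁ h₂ hv he => exact h₁.hasScheme.1.1.parallel h₂.hasScheme.1.1 hv
  | @series H₁ H₂ _ m _ h₁ h₂ hv =>
    exfalso
    have hm : ∀ x, x ∈ H₁.verts → x ∈ H₂.verts → x = m := fun x hx hx' => by
      have : x ∈ H₁.verts ∩ H₂.verts := ⟨hx, hx'⟩
      rwa [hv] at this
    have hcut := not_not.1 (hG.2 m)
    obtain ⟨p⟩ := hcut ⟨s, h₁.ne⟩ ⟨t, h₂.ne.symm⟩
    -- A walk that avoids `m` cannot leave `H₁`, so `m` would be a cut-vertex separating `s` from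
    -- `t`.
    have key : ∀ u v, (G.induce ({m}ᶜ : Set V)).Walk u v → (u : V) ∈ H₁.verts →
        (v : V) ∈ H₁.verts := by
      intro u v p
      induction p with
      | nil => exact id
      | @cons u v w h p ih =>
        intro hu
        apply ih
        have hadj : (⊤ : G.Subgraph).Adj u v := h
        rw [hK] at hadj
        rcases hadj with h | h
        · exact h.snd_mem
        · exact absurd (hm u hu h.fst_mem) u.2
    exact h₂.ne (hm t (key _ _ p h₁.source_mem) h₂.sink_mem).symm

end LocalCert

namespace LocalCert

/-! ### Certificates and their local verification -/

/-- The label of a vertex: its identifier, the identifiers of the two vertices of its pair, and its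
depth. -/
structure VertexLabel where
  ident : ℕ
  left : ℕ
  right : ℕ
  depth : ℕ

/-- A label, with the distance along which it has been forwarded. -/
structure Slot where
  label : VertexLabel
  dist : ℕ

/-- The slots hold the label of the vertex itself, of its parent, of the vertex whose label it
forwards, of the source, of the sink and of two vertices whose pair is formed by the source and the
sink. -/
abbrev Certificate := Fin 7 → Slot

instance : Nonempty Slot := ⟨⟨⟨0, 0, 0, 0⟩, 0⟩⟩

namespace Certificate

def own (c : Certificate) : VertexLabel := (c 0).label
def parent (c : Certificate) : VertexLabel := (c 1).label
def source (c : Certificate) : ℕ := (c 3).label.ident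
def sink (c : Certificate) : ℕ := (c 4).label.ident

/-- The identifier `i` is not the one of a terminal. -/
def Nonterminal (c : Certificate) (i : ℕ) : Prop := i ≠ c.source ∧ i ≠ c.sink

/-- The label is the one of a vertex whose pair is formed by the terminals. -/
def IsRoot (c : Certificate) (l : VertexLabel) : Prop :=
  c.Nonterminal l.ident ∧ l.left = c.source ∧ l.right = c.sink

end Certificate

/-- The conditions checked by a vertex with identifier `i` and certificate `c`, whose neighbours have
the identifiers and certificates in `N`. -/
structure LocallyValid (i : ℕ) (c : Certificate) (N : Set (ℕ × Certificate)) : Prop where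
  own : c.own.ident = i
  supported : ∀ m, (c m).label = c.own ∨
    ∃ q ∈ N, ∃ m', (q.2 m').label = (c m).label ∧ (q.2 m').dist < (c m).dist
  agree : ∀ q ∈ N, (q.2 3).label = (c 3).label ∧ (q.2 4).label = (c 4).label
  ne : c.source ≠ c.sink
  pair : c.Nonterminal i → (c.own.left = c.source ∧ c.own.right = c.sink) ∨
    (c.Nonterminal c.parent.ident ∧ c.parent.depth < c.own.depth ∧
      ((c.own.right = c.parent.ident ∧ c.own.left = c.parent.left) ∨
        (c.own.left = c.parent.ident ∧ c.own.right = c.parent.right)))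
  edge : ∀ q ∈ N, (i = c.source ∧ q.1 = c.sink) ∨ (i = c.sink ∧ q.1 = c.source) ∨
    (c.Nonterminal q.1 ∧ (i = q.2.own.left ∨ i = q.2.own.right)) ∨
    (c.Nonterminal i ∧ (q.1 = c.own.left ∨ q.1 = c.own.right))
  left : c.Nonterminal i →
    ∃ q ∈ N, q.1 = c.own.left ∨ (c.Nonterminal q.1 ∧ q.2.own.right = i)
  right : c.Nonterminal i →
    ∃ q ∈ N, q.1 = c.own.right ∨ (c.Nonterminal q.1 ∧ q.2.own.left = i)
  root : i = c.source → (∃ q ∈ N, q.1 = c.sink) ∨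
    ((c 5).label.ident ≠ (c 6).label.ident ∧ c.IsRoot (c 5).label ∧ c.IsRoot (c 6).label)

/-! ### Soundness and completeness of the local conditions -/

/-- Soundness: every label in a slot is the true label of some vertex, and connectedness makes all
vertices agree on the terminals, so the checks become the axioms of `SPLabelling`. -/
theorem twoConnectedSeriesParallel_of_locallyValid {V : Type} [Finite V] {G : SimpleGraph V}
    (hG : G.Connected) {ident : V → ℕ} (hident : Function.Injective ident) (c : V → Certificate)
    (h : ∀ v, LocallyValid (ident v) (c v) ((fun w => (ident w, c w)) '' G.neighborSet v)) :
    twoConnectedSeriesParallel V G := by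
  -- Following a neighbour that holds the same label at a smaller distance must stop, and it stops
  -- only at a vertex whose own label it is.
  have truth : ∀ v m, ∃ w, (c w).own = (c v m).label := by
    intro v m
    induction hd : (c v m).dist using Nat.strong_induction_on generalizing v m with
    | _ d ih =>
      subst hd
      rcases (h v).supported m with h' | ⟨_, ⟨w, -, rfl⟩, m', h₁, h₂⟩
      · exact ⟨v, h'.symm⟩
      · obtain ⟨u, hu⟩ := ih _ h₂ w m' rfl
        exact ⟨u, hu.trans h₁⟩
  obtain ⟨v₀⟩ := hG.nonempty
  have agree : ∀ v, (c v 3).label = (c v₀ 3).label ∧ (c v 4).label = (c v₀ 4).label := by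
    intro v
    obtain ⟨p⟩ := hG.preconnected v v₀
    induction p with
    | nil => exact ⟨rfl, rfl⟩
    | @cons u v w huv p ih =>
      have := (h u).agree _ ⟨v, huv, rfl⟩
      exact ⟨this.1.symm.trans ih.1, this.2.symm.trans ih.2⟩
  obtain ⟨s, hs⟩ := truth v₀ 3
  obtain ⟨t, ht⟩ := truth v₀ 4
  have hsource : ∀ v, (c v).source = ident s := fun v => by
    rw [← (h s).own, hs, Certificate.source, (agree v).1]
  have hsink : ∀ v, (c v).sink = ident t := fun v => by
    rw [← (h t).own, ht, Certificate.sink, (agree v).2]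
  have hnt : ∀ v x, (c v).Nonterminal (ident x) ↔ x ≠ s ∧ x ≠ t := fun v x => by
    rw [Certificate.Nonterminal, hsource, hsink, hident.ne_iff, hident.ne_iff]
  have hst : s ≠ t := by
    rintro rfl
    exact (h s).ne (by rw [hsource, hsink])
  have hpair : ∀ x, x ≠ s → x ≠ t → ((c x).own.left = ident s ∧ (c x).own.right = ident t) ∨
      ∃ p, p ≠ s ∧ p ≠ t ∧ (c p).own.depth < (c x).own.depth ∧
      (((c x).own.right = ident p ∧ (c x).own.left = (c p).own.left) ∨
        ((c x).own.left = ident p ∧ (c x).own.right = (c p).own.right)) := by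
    intro x hxs hxt
    have := (h x).pair ((hnt x x).2 ⟨hxs, hxt⟩)
    rw [hsource, hsink] at this
    refine this.imp_right fun ⟨h₁, h₂, h₃⟩ => ?_
    obtain ⟨p, hp⟩ := truth x 1
    change _ = (c x).parent at hp
    rw [← hp, (h p).own] at h₁ h₃
    rw [← hp] at h₂
    rw [hnt] at h₁
    exact ⟨p, h₁.1, h₁.2, h₂, h₃⟩
  -- The numbers written as ends of a pair are identifiers of actual vertices: each is that of a
  -- terminal, of the parent, or inherited from the parent, which is less deep.
  have hends : ∀ x, x ≠ s → x ≠ t →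
      (∃ y, ident y = (c x).own.left) ∧ ∃ y, ident y = (c x).own.right := by
    intro x
    induction hd : (c x).own.depth using Nat.strong_induction_on generalizing x with
    | _ d ih =>
      subst hd
      intro hxs hxt
      rcases hpair x hxs hxt with h' | ⟨p, hps, hpt, hlt, h' | h'⟩
      · exact ⟨⟨s, h'.1.symm⟩, ⟨t, h'.2.symm⟩⟩
      · exact ⟨by rw [h'.2]; exact (ih _ hlt p rfl hps hpt).1, ⟨p, h'.1.symm⟩⟩
      · exact ⟨⟨p, h'.1.symm⟩, by rw [h'.2]; exact (ih _ hlt p rfl hps hpt).2⟩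
  have hleft : ∀ x, ∃ y, x ≠ s → x ≠ t → ident y = (c x).own.left := fun x => by
    by_cases hx : x ≠ s ∧ x ≠ t
    · obtain ⟨y, hy⟩ := (hends x hx.1 hx.2).1
      exact ⟨y, fun _ _ => hy⟩
    · exact ⟨x, fun h₁ h₂ => absurd ⟨h₁, h₂⟩ hx⟩
  have hright : ∀ x, ∃ y, x ≠ s → x ≠ t → ident y = (c x).own.right := fun x => by
    by_cases hx : x ≠ s ∧ x ≠ t
    · obtain ⟨y, hy⟩ := (hends x hx.1 hx.2).2
      exact ⟨y, fun _ _ => hy⟩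
    · exact ⟨x, fun h₁ h₂ => absurd ⟨h₁, h₂⟩ hx⟩
  choose a ha using hleft
  choose b hb using hright
  have L : SPLabelling G s t a b (fun v => (c v).own.depth) :=
    { ne := hst
      parent := fun x hxs hxt => by
        have hx := hpair x hxs hxt
        rw [← ha x hxs hxt, ← hb x hxs hxt, hident.eq_iff, hident.eq_iff] at hx
        refine hx.imp_right fun ⟨p, hps, hpt, hlt, h'⟩ => ⟨p, hps, hpt, hlt, ?_⟩
        rwa [← ha p hps hpt, ← hb p hps hpt, hident.eq_iff, hident.eq_iff, hident.eq_iff,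
          hident.eq_iff] at h'
      edge := fun u v huv => by
        have := (h u).edge _ ⟨v, huv, rfl⟩
        simp only [hnt, hsource, hsink, hident.eq_iff] at this
        rcases this with h' | h' | ⟨h₁, h₂⟩ | ⟨h₁, h₂⟩
        · exact Or.inl h'
        · exact Or.inr (Or.inl h')
        · rw [← ha v h₁.1 h₁.2, ← hb v h₁.1 h₁.2, hident.eq_iff, hident.eq_iff] at h₂
          exact Or.inr (Or.inr (Or.inl ⟨h₁.1, h₁.2, h₂⟩))
        · rw [← ha u h₁.1 h₁.2, ← hb u h₁.1 h₁.2, hident.eq_iff, hident.eq_iff] at h₂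
          exact Or.inr (Or.inr (Or.inr ⟨h₁.1, h₁.2, h₂⟩))
      left := fun x hxs hxt => by
        obtain ⟨_, ⟨y, hy, rfl⟩, h'⟩ := (h x).left ((hnt x x).2 ⟨hxs, hxt⟩)
        refine ⟨y, hy, ?_⟩
        rw [hnt, ← ha x hxs hxt, hident.eq_iff] at h'
        refine h'.imp_right fun ⟨h₁, h₂⟩ => ⟨h₁.1, h₁.2, ?_⟩
        rwa [← hb y h₁.1 h₁.2, hident.eq_iff] at h₂
      right := fun x hxs hxt => by
        obtain ⟨_, ⟨y, hy, rfl⟩, h'⟩ := (h x).right ((hnt x x).2 ⟨hxs, hxt⟩)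
        refine ⟨y, hy, ?_⟩
        rw [hnt, ← hb x hxs hxt, hident.eq_iff] at h'
        refine h'.imp_right fun ⟨h₁, h₂⟩ => ⟨h₁.1, h₁.2, ?_⟩
        rwa [← ha y h₁.1 h₁.2, hident.eq_iff] at h₂ }
  refine L.twoConnectedSeriesParallel hG ?_
  have hroot : ∀ y, (c s).IsRoot (c y).own → y ≠ s ∧ y ≠ t ∧ a y = s ∧ b y = t := by
    rintro y ⟨h₁, h₂, h₃⟩
    rw [(h y).own, hnt] at h₁
    rw [← ha y h₁.1 h₁.2, hsource, hident.eq_iff] at h₂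
    rw [← hb y h₁.1 h₁.2, hsink, hident.eq_iff] at h₃
    exact ⟨h₁.1, h₁.2, h₂, h₃⟩
  rcases (h s).root (hsource s).symm with ⟨_, ⟨y, hy, rfl⟩, h'⟩ | ⟨h₁, h₂, h₃⟩
  · rw [hsink, hident.eq_iff] at h'
    exact Or.inl (h' ▸ hy)
  · obtain ⟨x, hx⟩ := truth s 5
    obtain ⟨y, hy⟩ := truth s 6
    rw [← hx] at h₁ h₂
    rw [← hy] at h₁ h₃
    exact Or.inr ⟨x, y, fun hxy => h₁ (by rw [hxy]), hroot x h₂, hroot y h₃⟩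

/-- If every vertex of `S` is joined to `w` by a connected subgraph inside `S`, distances to `w` can
be measured inside `S`. -/
theorem exists_distance {V : Type*} [Fintype V] {G : SimpleGraph V} (S : Set V) (w : V)
    (hS : ∀ x ∈ S, ∃ P : G.Subgraph, P.Connected ∧ x ∈ P.verts ∧ w ∈ P.verts ∧ P.verts ⊆ S) :
    ∃ d : V → ℕ, (∀ x, d x ≤ Fintype.card V) ∧
      ∀ x ∈ S, x ≠ w → ∃ y ∈ S, G.Adj x y ∧ d y < d x := by
  classical
  by_cases hw : w ∈ S
  swap
  · refine ⟨fun _ => 0, fun _ => Nat.zero_le _, fun x hx => ?_⟩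
    obtain ⟨P, -, -, h, h'⟩ := hS x hx
    exact absurd (h' h) hw
  have hreach : ∀ x (hx : x ∈ S), (G.induce S).Reachable ⟨x, hx⟩ ⟨w, hw⟩ := by
    intro x hx
    obtain ⟨P, hP, hxP, hwP, hPS⟩ := hS x hx
    let f : P.coe →g G.induce S := ⟨fun v => ⟨v, hPS v.2⟩, fun h => P.adj_sub h⟩
    exact (hP.preconnected ⟨x, hxP⟩ ⟨w, hwP⟩).map f
  refine ⟨fun x => if hx : x ∈ S then (G.induce S).dist ⟨x, hx⟩ ⟨w, hw⟩ else 0, fun x => ?_,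
    fun x hx hxw => ?_⟩
  · dsimp only
    split_ifs with hx
    · obtain ⟨p, hp, hl⟩ := (hreach x hx).exists_path_of_dist
      rw [← hl]
      -- A shortest path in the graph induced on `S` has fewer edges than `S` has vertices.
      exact hp.length_lt.le.trans (Fintype.card_subtype_le _)
    · exact Nat.zero_le _
  · obtain ⟨p, hl⟩ := (hreach x hx).exists_walk_length_eq_dist
    cases p with
    | nil => exact absurd rfl hxw
    | @cons _ y _ h p =>
      refine ⟨y, y.2, h, ?_⟩
      dsimp only
      rw [dif_pos hx, dif_pos y.2, ← hl, SimpleGraph.Walk.length_cons]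
      exact Nat.lt_succ_of_le (SimpleGraph.dist_le p)

/-- The entries of the certificate are at most `N`. -/
def Certificate.Bounded (c : Certificate) (N : ℕ) : Prop :=
  ∀ m, (c m).label.ident ≤ N ∧ (c m).label.left ≤ N ∧ (c m).label.right ≤ N ∧
    (c m).label.depth ≤ N ∧ (c m).dist ≤ N

/-- Completeness: the double scheme of the whole graph is written into the slots, with distances
measured inside the set of vertices that hold the same label. -/
theorem exists_locallyValid {V : Type} [Fintype V] {G : SimpleGraph V}
    (hC : twoConnectedSeriesParallel V G) {ident : V → ℕ} (hident : Function.Injective ident)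
    {N : ℕ} (hN : ∀ v, ident v ≤ N) (hV : Fintype.card V ≤ N) :
    ∃ c : V → Certificate, (∀ v, (c v).Bounded N) ∧
      ∀ v, LocallyValid (ident v) (c v) ((fun w => (ident w, c w)) '' G.neighborSet v) := by
  classical
  obtain ⟨h2, s, t, hsp⟩ := hC
  obtain ⟨D, hD, -, hroot⟩ := hsp.hasDoubleScheme h2
  obtain ⟨x₁, x₂, hroot⟩ : ∃ x₁ x₂, G.Adj s t ∨
      (x₁ ≠ x₂ ∧ D.Root (⊤ : G.Subgraph) s t x₁ ∧ D.Root (⊤ : G.Subgraph) s t x₂) := by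
    rcases hroot with h | ⟨x, y, h⟩
    -- When `st` is an edge the two root slots are not consulted as roots, but they must still hold
    -- a true label.
    · exact ⟨s, s, Or.inl h⟩
    · exact ⟨x, y, Or.inr h⟩
  have hI : ∀ x, Inner (⊤ : G.Subgraph) s t x ↔ x ≠ s ∧ x ≠ t := fun x => by simp [Inner]
  let know (w : V) : Set V := {y | y = w ∨ ((y ≠ s ∧ y ≠ t) ∧ (D.parent y = w ∨ D.transit y = w))}
  have hknow : ∀ w, ∃ d : V → ℕ, (∀ x, d x ≤ Fintype.card V) ∧
      ∀ x ∈ know w, x ≠ w → ∃ y ∈ know w, G.Adj x y ∧ d y < d x := by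
    refine fun w => exists_distance _ w fun x hx => ?_
    by_cases hxw : x = w
    · refine ⟨G.singletonSubgraph x, SimpleGraph.Subgraph.singletonSubgraph_connected, rfl,
        hxw.symm, ?_⟩
      rintro y rfl
      exact hx
    have hf : D.Forwards (⊤ : G.Subgraph) s t w x := by
      obtain ⟨hst, rfl | rfl⟩ := hx.resolve_left hxw
      · exact hD.known x ((hI x).2 hst)
      · exact hD.forwarded x ((hI x).2 hst) (Ne.symm hxw)
    obtain ⟨P, -, hP, hxP, hwP, hy⟩ := hf
    exact ⟨P, hP, hxP, hwP, fun y hyP => (hy y hyP).imp_right fun h => ⟨(hI y).1 h.1, h.2⟩⟩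
  have hall : ∀ w, ∃ d : V → ℕ, (∀ x, d x ≤ Fintype.card V) ∧
      ∀ x ∈ Set.univ, x ≠ w → ∃ y ∈ Set.univ, G.Adj x y ∧ d y < d x := by
    refine fun w => exists_distance _ w fun x _ => ⟨⊤, hsp.connected, trivial, trivial,
      Set.subset_univ _⟩
  choose d hdle hd using hknow
  choose e hele he using hall
  let label (v : V) : VertexLabel :=
    -- The depth is replaced by its rank, which keeps strict inequalities and is at most `n`.
    ⟨ident v, ident (D.left v), ident (D.right v), Finset.card {y | D.depth y < D.depth v}⟩
  have hdepth : ∀ x y, D.depth x < D.depth y → (label x).depth < (label y).depth := by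
    intro x y hxy
    apply Finset.card_lt_card
    rw [Finset.ssubset_iff_of_subset]
    · exact ⟨x, by simpa using hxy, by simp⟩
    · intro z hz
      simp only [Finset.mem_filter_univ] at hz ⊢
      exact hz.trans hxy
  -- A scheme says nothing about the terminals; their slots hold their own label.
  let par (v : V) : V := if v ≠ s ∧ v ≠ t then D.parent v else v
  let tra (v : V) : V := if v ≠ s ∧ v ≠ t then D.transit v else v
  let c (v : V) : Certificate :=
    ![⟨label v, 0⟩, ⟨label (par v), d (par v) v⟩, ⟨label (tra v), d (tra v) v⟩,
      ⟨label s, e s v⟩, ⟨label t, e t v⟩, ⟨label x₁, e x₁ v⟩, ⟨label x₂, e x₂ v⟩]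
  have hown : ∀ v, (c v).own = label v := fun v => rfl
  have hnt : ∀ v x, (c v).Nonterminal (ident x) ↔ x ≠ s ∧ x ≠ t := fun v x => by
    change ident x ≠ ident s ∧ ident x ≠ ident t ↔ _
    rw [hident.ne_iff, hident.ne_iff]
  have hlocal : ∀ v w m, v ∈ know w → (c v m).label = label w → (c v m).dist = d w v →
      (c v m).label = (c v).own ∨ ∃ q ∈ (fun w => (ident w, c w)) '' G.neighborSet v, ∃ m',
      (q.2 m').label = (c v m).label ∧ (q.2 m').dist < (c v m).dist := by
    intro v w m hv hl hdist
    rw [hl, hdist, hown]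
    by_cases hvw : v = w
    · exact Or.inl (by rw [hvw])
    obtain ⟨y, hy, hvy, hlt⟩ := hd w v hv hvw
    -- The closer vertex `y` holds the label of `w` as its own, as its parent's or as its transit,
    -- that is, in slot 0, 1 or 2.
    refine Or.inr ⟨_, ⟨y, hvy, rfl⟩, ?_⟩
    rcases hy with rfl | ⟨hy, rfl | rfl⟩
    · exact ⟨0, rfl, (Nat.zero_le _).trans_lt hlt⟩
    · have : par y = D.parent y := if_pos hy
      rw [← this] at hlt ⊢
      exact ⟨1, rfl, hlt⟩
    · have : tra y = D.transit y := if_pos hy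
      rw [← this] at hlt ⊢
      exact ⟨2, rfl, hlt⟩
  have hglobal : ∀ v w m, (∀ v, (c v m).label = label w ∧ (c v m).dist = e w v) →
      (c v m).label = (c v).own ∨ ∃ q ∈ (fun w => (ident w, c w)) '' G.neighborSet v, ∃ m',
      (q.2 m').label = (c v m).label ∧ (q.2 m').dist < (c v m).dist := by
    intro v w m hm
    rw [(hm v).1, (hm v).2, hown]
    by_cases hvw : v = w
    · exact Or.inl (by rw [hvw])
    obtain ⟨y, -, hvy, hlt⟩ := he w v trivial hvw
    exact Or.inr ⟨_, ⟨y, hvy, rfl⟩, m, (hm y).1, by rw [(hm y).2]; exact hlt⟩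
  have hpar : ∀ v, v ∈ know (par v) := fun v => by
    by_cases hv : v ≠ s ∧ v ≠ t
    · exact Or.inr ⟨hv, Or.inl (if_pos hv).symm⟩
    · exact Or.inl (if_neg hv).symm
  have htra : ∀ v, v ∈ know (tra v) := fun v => by
    by_cases hv : v ≠ s ∧ v ≠ t
    · exact Or.inr ⟨hv, Or.inr (if_pos hv).symm⟩
    · exact Or.inl (if_neg hv).symm
  refine ⟨c, fun v => ?_, fun v => ⟨rfl, ?_, ?_, ?_, ?_, ?_, ?_, ?_, ?_⟩⟩
  · have hl : ∀ w, (label w).ident ≤ N ∧ (label w).left ≤ N ∧ (label w).right ≤ N ∧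
        (label w).depth ≤ N := fun w => ⟨hN _, hN _, hN _, (Finset.card_le_univ _).trans hV⟩
    have hb : ∀ w k, k ≤ N → (label w).ident ≤ N ∧ (label w).left ≤ N ∧ (label w).right ≤ N ∧
        (label w).depth ≤ N ∧ k ≤ N :=
      fun w k hk => ⟨(hl w).1, (hl w).2.1, (hl w).2.2.1, (hl w).2.2.2, hk⟩
    intro m
    fin_cases m
    · exact hb _ _ (Nat.zero_le _)
    · exact hb _ _ ((hdle _ _).trans hV)
    · exact hb _ _ ((hdle _ _).trans hV)
    · exact hb _ _ ((hele _ _).trans hV)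
    · exact hb _ _ ((hele _ _).trans hV)
    · exact hb _ _ ((hele _ _).trans hV)
    · exact hb _ _ ((hele _ _).trans hV)
  · intro m
    fin_cases m
    · exact Or.inl rfl
    · exact hlocal v (par v) 1 (hpar v) rfl rfl
    · exact hlocal v (tra v) 2 (htra v) rfl rfl
    · exact hglobal v s 3 fun _ => ⟨rfl, rfl⟩
    · exact hglobal v t 4 fun _ => ⟨rfl, rfl⟩
    · exact hglobal v x₁ 5 fun _ => ⟨rfl, rfl⟩
    · exact hglobal v x₂ 6 fun _ => ⟨rfl, rfl⟩
  · rintro _ ⟨w, -, rfl⟩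
    exact ⟨rfl, rfl⟩
  · exact fun h => hD.ne (hident h)
  · intro hv
    rw [hnt] at hv
    have hp : (c v).parent = label (D.parent v) := congrArg label (if_pos hv)
    rw [hp, hown]
    rcases hD.pair v ((hI v).2 hv) with ⟨h₁, h₂, -⟩ | ⟨h₁, h₂, h₃⟩
    · exact Or.inl ⟨congrArg ident h₁, congrArg ident h₂⟩
    · refine Or.inr ⟨(hnt v _).2 ((hI _).1 h₁), hdepth _ _ h₂, ?_⟩
      exact h₃.imp (fun h => ⟨congrArg ident h.1, congrArg ident h.2⟩)
        fun h => ⟨congrArg ident h.1, congrArg ident h.2⟩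
  · rintro _ ⟨w, hw, rfl⟩
    rw [hnt, hnt]
    have := hD.edge v w hw
    rw [hI, hI] at this
    exact this.imp (fun h => ⟨congrArg ident h.1, congrArg ident h.2⟩)
      (Or.imp (fun h => ⟨congrArg ident h.1, congrArg ident h.2⟩)
      (Or.imp (fun h => ⟨h.1, h.2.imp (congrArg ident) (congrArg ident)⟩)
        fun h => ⟨h.1, h.2.imp (congrArg ident) (congrArg ident)⟩))
  · intro hv
    rw [hnt] at hv
    obtain ⟨y, hy, h⟩ := hD.left v ((hI v).2 hv)
    refine ⟨_, ⟨y, hy, rfl⟩, h.imp (congrArg ident) fun h => ⟨?_, congrArg ident h.2⟩⟩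
    exact (hnt v y).2 ((hI y).1 h.1)
  · intro hv
    rw [hnt] at hv
    obtain ⟨y, hy, h⟩ := hD.right v ((hI v).2 hv)
    refine ⟨_, ⟨y, hy, rfl⟩, h.imp (congrArg ident) fun h => ⟨?_, congrArg ident h.2⟩⟩
    exact (hnt v y).2 ((hI y).1 h.1)
  · intro hv
    obtain rfl : v = s := hident hv
    rcases hroot with h | ⟨hne, h₁, h₂⟩
    · exact Or.inl ⟨_, ⟨t, h, rfl⟩, rfl⟩
    · exact Or.inr ⟨fun h => hne (hident h),
        ⟨(hnt v x₁).2 ((hI _).1 h₁.1), congrArg ident h₁.2.1, congrArg ident h₁.2.2⟩,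
        ⟨(hnt v x₂).2 ((hI _).1 h₂.1), congrArg ident h₂.2.1, congrArg ident h₂.2.2⟩⟩

/-! ### Binary encoding -/

/-- A self-delimiting code for bit strings. -/
def delimit : List Bool → List Bool
  | [] => [false]
  | b :: l => true :: b :: delimit l

/-- Each bit is preceded by `true` and the end is marked by `false`, so the code is prefix-free and
concatenations can be parsed. -/
theorem delimit_append_inj {l l' r r' : List Bool} (h : delimit l ++ r = delimit l' ++ r') :
    l = l' ∧ r = r' := by
  induction l generalizing l' with
  | nil =>
    cases l' with
    | nil => simpa [delimit] using h
    | cons b l' => simp [delimit] at h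
  | cons b l ih =>
    cases l' with
    | nil => simp [delimit] at h
    | cons b' l' =>
      simp only [delimit, List.cons_append, List.cons.injEq, true_and] at h
      obtain ⟨rfl, rfl⟩ := ih h.2
      exact ⟨by rw [h.1], rfl⟩

theorem length_delimit (l : List Bool) : (delimit l).length = 2 * l.length + 1 := by
  induction l with
  | nil => rfl
  | cons b l ih =>
    simp only [delimit, List.length_cons, ih]
    omega

theorem bits_injective : Function.Injective Nat.bits := fun m n h =>
  Nat.eq_of_testBit_eq fun i => by rw [Nat.testBit_eq_inth, Nat.testBit_eq_inth, h]

/-- A self-delimiting code for natural numbers. -/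
def encodeNat (n : ℕ) : List Bool := delimit n.bits

theorem encodeNat_append_inj {m n : ℕ} {r r' : List Bool}
    (h : encodeNat m ++ r = encodeNat n ++ r') : m = n ∧ r = r' :=
  (delimit_append_inj h).imp_left fun h => bits_injective h

theorem length_encodeNat_le {n N : ℕ} (h : n ≤ N) : (encodeNat n).length ≤ 2 * N.size + 1 := by
  rw [encodeNat, length_delimit, Nat.size_eq_bits_len]
  have := Nat.size_le_size h
  omega

def Slot.encode (S : Slot) : List Bool :=
  encodeNat S.label.ident ++ (encodeNat S.label.left ++ (encodeNat S.label.right ++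
    (encodeNat S.label.depth ++ encodeNat S.dist)))

theorem Slot.encode_append_inj {S S' : Slot} {r r' : List Bool}
    (h : S.encode ++ r = S'.encode ++ r') : S = S' ∧ r = r' := by
  obtain ⟨⟨i, a, b, d⟩, e⟩ := S
  obtain ⟨⟨i', a', b', d'⟩, e'⟩ := S'
  simp only [Slot.encode, List.append_assoc] at h
  obtain ⟨rfl, h1⟩ := encodeNat_append_inj h
  obtain ⟨rfl, h2⟩ := encodeNat_append_inj h1
  obtain ⟨rfl, h3⟩ := encodeNat_append_inj h2
  obtain ⟨rfl, h4⟩ := encodeNat_append_inj h3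
  obtain ⟨rfl, h5⟩ := encodeNat_append_inj h4
  exact ⟨rfl, h5⟩

def Certificate.encode (c : Certificate) : List Bool := (List.ofFn c).flatMap Slot.encode

theorem Certificate.encode_injective : Function.Injective Certificate.encode := by
  have key : ∀ l l' : List Slot, l.length = l'.length →
      l.flatMap Slot.encode = l'.flatMap Slot.encode → l = l' := by
    intro l
    induction l with
    | nil =>
      intro l' hl _
      exact (List.length_eq_zero_iff.1 hl.symm).symm
    | cons S l ih =>
      rintro (_ | ⟨S', l'⟩) hl h
      · simp at hl
      · rw [List.flatMap_cons, List.flatMap_cons] at h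
        obtain ⟨rfl, h'⟩ := Slot.encode_append_inj h
        rw [ih l' (by simpa using hl) h']
  exact fun c c' h => List.ofFn_injective (key _ _ (by simp) h)

theorem Certificate.length_encode_le {c : Certificate} {N : ℕ} (h : c.Bounded N) :
    c.encode.length ≤ 35 * (2 * N.size + 1) := by
  have hS : ∀ m, (c m).encode.length ≤ 5 * (2 * N.size + 1) := by
    intro m
    obtain ⟨h₁, h₂, h₃, h₄, h₅⟩ := h m
    have h₁ := length_encodeNat_le h₁
    have h₂ := length_encodeNat_le h₂
    have h₃ := length_encodeNat_le h₃
    have h₄ := length_encodeNat_le h₄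
    have h₅ := length_encodeNat_le h₅
    simp only [Slot.encode, List.length_append]
    omega
  rw [Certificate.encode, List.length_flatMap, List.map_ofFn, List.sum_ofFn]
  calc _ ≤ ∑ _m : Fin 7, 5 * (2 * N.size + 1) := Finset.sum_le_sum fun m _ => hS m
    _ = 35 * (2 * N.size + 1) := by
      rw [Finset.sum_const, Finset.card_univ, Fintype.card_fin, smul_eq_mul]
      ring

theorem isBigO_size_pow (k : ℕ) :
    (fun n : ℕ => ((35 * (2 * (n ^ (k + 1)).size + 1) : ℕ) : ℝ)) =O[Filter.atTop]
      (fun n : ℕ => Real.log (n : ℝ)) := by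
  have hlog2 : 0 < Real.log 2 := Real.log_pos (by norm_num)
  -- The size of `n ^ (k + 1)` is at most `(k + 1) * log n / log 2 + 1`, and the constant terms are
  -- absorbed through `log 2 ≤ log n`.
  refine Asymptotics.IsBigO.of_bound (35 * (2 * ((k + 1) + 1) + 1) / Real.log 2) ?_
  filter_upwards [Filter.eventually_ge_atTop 2] with n hn
  have hn' : (2 : ℝ) ≤ n := by exact_mod_cast hn
  have hlog : Real.log 2 ≤ Real.log n := Real.log_le_log (by norm_num) hn'
  have hpos : 0 < n ^ (k + 1) := by positivity
  obtain ⟨j, hj⟩ : ∃ j, (n ^ (k + 1)).size = j + 1 :=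
    Nat.exists_eq_succ_of_ne_zero (Nat.size_pos.2 hpos).ne'
  have h2 : 2 ^ j ≤ n ^ (k + 1) := Nat.lt_size.1 (by omega)
  have h3 : (j : ℝ) * Real.log 2 ≤ (k + 1) * Real.log n := by
    have := Real.log_le_log (by positivity) (show ((2 : ℝ) ^ j) ≤ (n : ℝ) ^ (k + 1) by
      exact_mod_cast h2)
    rw [Real.log_pow, Real.log_pow] at this
    push_cast at this
    exact this
  rw [Real.norm_of_nonneg (Nat.cast_nonneg _), Real.norm_of_nonneg (hlog2.le.trans hlog), hj,
    div_mul_eq_mul_div, le_div_iff₀ hlog2]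
  push_cast
  nlinarith

/-- The verifier that decodes the certificates and checks their local validity. -/
noncomputable def spVerifier : Verifier := by
  classical
  exact fun L =>
    -- A string that is not a code decodes to an arbitrary certificate; this is harmless, since
    -- soundness holds for all certificates.
    let decode := Function.invFun Certificate.encode
    decide (LocallyValid L.ident (decode L.cert) ((fun q => (q.1, decode q.2)) '' L.nbrs))

theorem spVerifier_accepts_iff {V : Type} (G : SimpleGraph V) (ident : V → ℕ)
    (c : V → List Bool) : spVerifier.Accepts G ident c ↔
      ∀ v, LocallyValid (ident v) (Function.invFun Certificate.encode (c v))
        ((fun w => (ident w, Function.invFun Certificate.encode (c w))) '' G.neighborSet v) := by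
  classical
  refine forall_congr' fun v => ?_
  rw [spVerifier, decide_eq_true_iff, localView, Set.image_image]

end LocalCert

theorem mainTheorem9 (k : ℕ) :
    ∃ f : ℕ → ℕ,
      (fun n : ℕ => (f n : ℝ)) =O[Filter.atTop] (fun n : ℕ => Real.log (n : ℝ)) ∧
      LocalCert.CertifiableWith k LocalCert.twoConnectedSeriesParallel f := by
  -- The exponent `k + 1` makes `n ^ (k + 1)` bound the identifiers and also `n`, hence the depths
  -- and distances, even for `k = 0`.
  refine ⟨fun n => 35 * (2 * (n ^ (k + 1)).size + 1), LocalCert.isBigO_size_pow k,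
    LocalCert.spVerifier, fun V _ G hG ident hident => ⟨fun hC => ?_, fun hC c hc => hC ?_⟩⟩
  · have := hG.nonempty
    have hpos : 0 < Fintype.card V := Fintype.card_pos
    have hident_le : ∀ v, ident v ≤ Fintype.card V ^ (k + 1) := fun v =>
      (hident.2 v).2.trans (Nat.pow_le_pow_right hpos (Nat.le_succ k))
    obtain ⟨c, hc, hv⟩ := LocalCert.exists_locallyValid hC hident.1 hident_le
      (Nat.le_self_pow (Nat.succ_ne_zero k) _)
    refine ⟨fun v => (c v).encode, fun v => LocalCert.Certificate.length_encode_le (hc v), ?_⟩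
    rw [LocalCert.spVerifier_accepts_iff]
    have hinv := Function.leftInverse_invFun LocalCert.Certificate.encode_injective
    simpa only [hinv _] using hv
  · rw [LocalCert.spVerifier_accepts_iff] at hc
    exact LocalCert.twoConnectedSeriesParallel_of_locallyValid hG hident.1 _ hc
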